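/- Let $\mathcal G$ be a second-countable locally compact Hausdorff topological groupoid with unit space $\mathcal G^{(0)}$, range and source maps $r,s$, and set $\mathcal G_x=s^{-1}(x)$. Let $\lambda=\{\lambda_x\}_{x\in\mathcal G^{(0)}}$ be a Haar system on $\mathcal G$: each $\lambda_x$ is a Radon measure with support $\mathcal G_x$, for every $f\in C_c(\mathcal G)$ the function $x\mapsto\int f\,d\lambda_x$ is continuous, and $\int f(\gamma\eta)\,d\lambda_{r(\eta)}(\gamma)=\int f(\gamma)\,d\lambda_{s(\eta)}(\gamma)$ for all $\eta\in\mathcal G$ and $f\in C_c(\mathcal G)$. Let $\sigma:\mathcal G^{(2)}\to\mathbb T$ be a normalized continuous 2-cocycle on the set $\mathcal G^{(2)}$ of composable pairs, i.e. a continuous map with $\sigma(r(\gamma),\gamma)=1=\sigma(\gamma,s(\gamma))$ and $\sigma(\alpha,\beta)\sigma(\alpha\beta,\gamma)=\sigma(\beta,\gamma)\sigma(\alpha,\beta\gamma)$ whenever $(\alpha,\beta),(\beta,\gamma)\in\mathcal G^{(2)}$. Let $L^1(\mathcal G,\sigma,\lambda)$ be the Banach $*$-algebra obtained by completing $C_c(\mathcal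 G)$, with product $$(f\star_\sigma g)(\gamma)=\int_{\mathcal G_{s(\gamma)}} f(\gamma\mu^{-1})g(\mu)\sigma(\gamma\mu^{-1},\mu)\,d\lambda_{s(\gamma)}(\mu)$$ and involution $f^{*_\sigma}(\gamma)=\overline{\sigma(\gamma^{-1},\gamma)}\,\overline{f(\gamma^{-1})}$, in the norm $$\|f\|_I=\sup_{x\in\mathcal G^{(0)}}\max\Big\{\int_{\mathcal G_x}|f(\gamma)|\,d\lambda_x(\gamma),\ \int_{\mathcal G_x}|f(\gamma^{-1})|\,d\lambda_x(\gamma)\Big\}.$$ For the trivial cocycle $\sigma\equiv 1$ write $L^1(\mathcal G,\lambda)$. Let $\mathcal G_\sigma$ be the groupoid $\mathcal G\times\mathbb T$ with the product topology, product $(\gamma_1,z_1)(\gamma_2,z_2)=(\gamma_1\gamma_2,\,z_1z_2\overline{\sigma(\gamma_1,\gamma_2)})$ for $(\gamma_1,\gamma_2)\in\mathcal G^{(2)}$, inverse $(\gamma,z)^{-1}=(\gamma^{-1},\,\overline z\,\sigma(\gamma,\gamma^{-1}))$, unit space $\mathcal G^{(0)}\times\{1\}\cong\mathcal G^{(0)}$,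 and Haar system $\lambda\times\eta=\{\lambda_x\times\eta\}_{x\in\mathcal G^{(0)}}$, where $\eta$ is normalized Lebesgue measure on $\mathbb T$. A Banach $*$-algebra is called Hermitian if each of its self-adjoint elements has real spectrum, where the spectrum is taken in the algebra if it is unital and in its minimal unitization otherwise. If $L^1(\mathcal G_\sigma,\lambda\times\eta)$ is Hermitian, then $L^1(\mathcal G,\sigma,\lambda)$ is Hermitian. -/

import Mathlib

open MeasureTheory Filter UniformSpace
open scoped Topology CompactlySupported ComplexConjugate

/-! ## Topological groupoids, Haar systems, 2-cocycles -/

/-- A topological groupoid with space of arrows `G` and unit space `X`.  The partial product is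
encoded by a total function `mul` of which only the values on composable pairs (`src a = rng b`)
are ever used. The unit space is identified with the set of units through `unit`; as `unit` and
`src` are continuous, `unit` is a homeomorphism onto its image. -/
structure TopGroupoid (G X : Type*) [TopologicalSpace G] [TopologicalSpace X] where
  src : G → X
  rng : G → X
  unit : X → G
  inv : G → G
  mul : G → G → G
  src_unit : ∀ x, src (unit x) = x
  rng_unit : ∀ x, rng (unit x) = x
  src_inv : ∀ a, src (inv a) = rng a
  rng_inv : ∀ a, rng (inv a) = src a
  src_mul : ∀ a b, src a = rng b → src (mul a b) = src b
  rng_mul : ∀ a b, src a = rng b → rng (mul a b) = rng a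
  mul_assoc : ∀ a b c, src a = rng b → src b = rng c → mul (mul a b) c = mul a (mul b c)
  unit_mul : ∀ a, mul (unit (rng a)) a = a
  mul_unit : ∀ a, mul a (unit (src a)) = a
  inv_mul : ∀ a, mul (inv a) a = unit (src a)
  mul_inv : ∀ a, mul a (inv a) = unit (rng a)
  continuous_src : Continuous src
  continuous_rng : Continuous rng
  continuous_unit : Continuous unit
  continuous_inv : Continuous inv
  continuousOn_mul : ContinuousOn (fun p : G × G => mul p.1 p.2) {p | src p.1 = rng p.2}

/-- A (right invariant) Haar system: Radon measures `meas x` with support the source fibre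
`G_x = {γ | src γ = x}`. (On a second-countable locally compact Hausdorff space, Radon measures are
the Borel measures that are finite on compact sets.) -/
structure HaarSystem {G X : Type*} [TopologicalSpace G] [TopologicalSpace X] [MeasurableSpace G]
    (𝒢 : TopGroupoid G X) where
  meas : X → Measure G
  finite_on_compacts : ∀ x, IsFiniteMeasureOnCompacts (meas x)
  support_eq : ∀ x, (meas x).support = {γ | 𝒢.src γ = x}
  continuous_integral : ∀ f : C_c(G, ℂ), Continuous fun x => ∫ γ, f γ ∂(meas x)
  invariant : ∀ (η : G) (f : C_c(G, ℂ)),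
    ∫ γ, f (𝒢.mul γ η) ∂(meas (𝒢.rng η)) = ∫ γ, f γ ∂(meas (𝒢.src η))

/-- A normalized continuous `𝕋`-valued 2-cocycle. Only the values on composable pairs matter. -/
structure GroupoidCocycle {G X : Type*} [TopologicalSpace G] [TopologicalSpace X]
    (𝒢 : TopGroupoid G X) where
  toFun : G → G → Circle
  continuousOn : ContinuousOn (fun p : G × G => toFun p.1 p.2) {p | 𝒢.src p.1 = 𝒢.rng p.2}
  unit_left : ∀ γ, toFun (𝒢.unit (𝒢.rng γ)) γ = 1
  unit_right : ∀ γ, toFun γ (𝒢.unit (𝒢.src γ)) = 1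
  cocycle : ∀ α β γ, 𝒢.src α = 𝒢.rng β → 𝒢.src β = 𝒢.rng γ →
    toFun α β * toFun (𝒢.mul α β) γ = toFun β γ * toFun α (𝒢.mul β γ)

instance {G X : Type*} [TopologicalSpace G] [TopologicalSpace X] (𝒢 : TopGroupoid G X) :
    CoeFun (GroupoidCocycle 𝒢) fun _ => G → G → Circle := ⟨GroupoidCocycle.toFun⟩

/-- The trivial cocycle. -/
noncomputable def GroupoidCocycle.trivial {G X : Type*} [TopologicalSpace G] [TopologicalSpace X]
    (𝒢 : TopGroupoid G X) : GroupoidCocycle 𝒢 where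
  toFun _ _ := 1
  continuousOn := continuousOn_const
  unit_left _ := rfl
  unit_right _ := rfl
  cocycle _ _ _ _ _ := rfl

namespace TopGroupoid

variable {G X : Type*} [TopologicalSpace G] [TopologicalSpace X] (𝒢 : TopGroupoid G X)

theorem t2Space (𝒢 : TopGroupoid G X) [T2Space G] : T2Space X :=
  T2Space.of_injective_continuous (f := 𝒢.unit)
    (fun x y h => by rw [← 𝒢.src_unit x, h, 𝒢.src_unit]) 𝒢.continuous_unit

theorem inv_mul_cancel_left {a b : G} (h : 𝒢.src a = 𝒢.rng b) :
    𝒢.mul (𝒢.inv a) (𝒢.mul a b) = b := by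
  rw [← 𝒢.mul_assoc _ _ _ (𝒢.src_inv a) h, 𝒢.inv_mul, h, 𝒢.unit_mul]

theorem mul_inv_cancel_right {a b : G} (h : 𝒢.src a = 𝒢.rng b) :
    𝒢.mul (𝒢.mul a b) (𝒢.inv b) = a := by
  rw [𝒢.mul_assoc _ _ _ h (𝒢.rng_inv b).symm, 𝒢.mul_inv, ← h, 𝒢.mul_unit]

theorem inv_mul_cancel_right {a b : G} (h : 𝒢.src a = 𝒢.src b) :
    𝒢.mul (𝒢.mul a (𝒢.inv b)) b = a := by
  rw [𝒢.mul_assoc _ _ _ (h.trans (𝒢.rng_inv b).symm) (𝒢.src_inv b), 𝒢.inv_mul, ← h, 𝒢.mul_unit]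

theorem src_div {a b : G} (h : 𝒢.src a = 𝒢.src b) :
    𝒢.src (𝒢.mul a (𝒢.inv b)) = 𝒢.rng b := by
  rw [𝒢.src_mul _ _ (h.trans (𝒢.rng_inv b).symm), 𝒢.src_inv]

theorem rng_div {a b : G} (h : 𝒢.src a = 𝒢.src b) :
    𝒢.rng (𝒢.mul a (𝒢.inv b)) = 𝒢.rng a := by
  rw [𝒢.rng_mul _ _ (h.trans (𝒢.rng_inv b).symm)]

theorem inv_inv (a : G) : 𝒢.inv (𝒢.inv a) = a := by
  have h3 := 𝒢.inv_mul_cancel_left (a := 𝒢.inv a) (b := a) (𝒢.src_inv a)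
  rw [𝒢.inv_mul] at h3
  have h4 := 𝒢.mul_unit (𝒢.inv (𝒢.inv a))
  rw [𝒢.src_inv, 𝒢.rng_inv, h3] at h4
  exact h4.symm

theorem inv_div {a b : G} (h : 𝒢.src a = 𝒢.src b) :
    𝒢.inv (𝒢.mul a (𝒢.inv b)) = 𝒢.mul b (𝒢.inv a) := by
  have h1 : 𝒢.src (𝒢.mul a (𝒢.inv b)) = 𝒢.rng (𝒢.mul b (𝒢.inv a)) := by
    rw [𝒢.src_div h, 𝒢.rng_div h.symm]
  have h2 : 𝒢.mul (𝒢.mul a (𝒢.inv b)) (𝒢.mul b (𝒢.inv a)) = 𝒢.unit (𝒢.rng a) := by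
    rw [← 𝒢.mul_assoc _ _ _ (𝒢.src_div h) (h.symm.trans (𝒢.rng_inv a).symm),
      𝒢.inv_mul_cancel_right h, 𝒢.mul_inv]
  have h3 := 𝒢.inv_mul_cancel_left h1
  rw [h2] at h3
  rw [← h3]
  have h4 := 𝒢.mul_unit (𝒢.inv (𝒢.mul a (𝒢.inv b)))
  rw [𝒢.src_inv, 𝒢.rng_div h] at h4
  exact h4.symm

/-- `(γ ν⁻¹) (ν μ⁻¹) = γ μ⁻¹`. -/
theorem div_mul_div {a b c : G} (h : 𝒢.src a = 𝒢.src b) (h' : 𝒢.src b = 𝒢.src c) :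
    𝒢.mul (𝒢.mul a (𝒢.inv b)) (𝒢.mul b (𝒢.inv c)) = 𝒢.mul a (𝒢.inv c) := by
  rw [← 𝒢.mul_assoc _ _ _ (𝒢.src_div h) (h'.trans (𝒢.rng_inv c).symm), 𝒢.inv_mul_cancel_right h]

/-- `(γ μ⁻¹) (ν μ⁻¹)⁻¹ = γ ν⁻¹`. -/
theorem div_div_div {a b c : G} (h : 𝒢.src a = 𝒢.src b) (h' : 𝒢.src b = 𝒢.src c) :
    𝒢.mul (𝒢.mul a (𝒢.inv c)) (𝒢.inv (𝒢.mul b (𝒢.inv c))) = 𝒢.mul a (𝒢.inv b) := by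
  rw [𝒢.inv_div h', 𝒢.div_mul_div (h.trans h') h'.symm]

theorem continuousOn_div : ContinuousOn (fun p : G × G => 𝒢.mul p.1 (𝒢.inv p.2))
    {p | 𝒢.src p.1 = 𝒢.src p.2} :=
  𝒢.continuousOn_mul.comp (f := fun p : G × G => (p.1, 𝒢.inv p.2))
    (continuous_fst.prodMk (𝒢.continuous_inv.comp continuous_snd)).continuousOn
    (fun p hp => by simpa [𝒢.rng_inv] using hp)

theorem isClosed_composable [T2Space G] : IsClosed {p : G × G | 𝒢.src p.1 = 𝒢.rng p.2} :=
  have := 𝒢.t2Space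
  isClosed_eq (𝒢.continuous_src.comp continuous_fst) (𝒢.continuous_rng.comp continuous_snd)

theorem isClosed_fibre [T2Space G] (x : X) : IsClosed {γ | 𝒢.src γ = x} :=
  have := 𝒢.t2Space
  isClosed_eq 𝒢.continuous_src continuous_const

/-- The product set `K L`. -/
def mulSet (K L : Set G) : Set G :=
  (fun p : G × G => 𝒢.mul p.1 p.2) '' ((K ×ˢ L) ∩ {p | 𝒢.src p.1 = 𝒢.rng p.2})

theorem isCompact_mulSet [T2Space G] {K L : Set G} (hK : IsCompact K) (hL : IsCompact L) :
    IsCompact (𝒢.mulSet K L) :=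
  ((hK.prod hL).inter_right 𝒢.isClosed_composable).image_of_continuousOn
    (𝒢.continuousOn_mul.mono Set.inter_subset_right)

theorem mem_mulSet_of_div {K L : Set G} {a b : G} (h : 𝒢.src a = 𝒢.src b)
    (hK : 𝒢.mul a (𝒢.inv b) ∈ K) (hL : b ∈ L) : a ∈ 𝒢.mulSet K L :=
  ⟨(𝒢.mul a (𝒢.inv b), b), ⟨⟨hK, hL⟩, 𝒢.src_div h⟩, 𝒢.inv_mul_cancel_right h⟩

end TopGroupoid

theorem exists_compactlySupported_eqOn {Y : Type*} [TopologicalSpace Y] [T2Space Y]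
    [LocallyCompactSpace Y] [SecondCountableTopology Y] {C K : Set Y} (hC : IsClosed C)
    (hK : IsCompact K) {F : Y → ℂ} (hF : ContinuousOn F C) (h0 : ∀ y ∈ C, y ∉ K → F y = 0) :
    ∃ f : C_c(Y, ℂ), Set.EqOn f F C := by
  obtain ⟨g, hg⟩ := ContinuousMap.exists_restrict_eq hC ⟨C.domRestrict F, hF.domRestrict⟩
  obtain ⟨χ, h1, -, hχ, -⟩ := exists_continuous_one_zero_of_isCompact hK isClosed_empty
    (Set.disjoint_empty K)
  refine ⟨⟨⟨fun y => (χ y : ℂ) * g y, by fun_prop⟩, ?_⟩, ?_⟩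
  · exact HasCompactSupport.mul_right (hχ.comp_left (g := ((↑) : ℝ → ℂ)) Complex.ofReal_zero)
  · intro y hy
    have hgy : g y = F y := congrArg (fun f : C(C, ℂ) => f ⟨y, hy⟩) hg
    change (χ y : ℂ) * g y = F y
    by_cases hyK : y ∈ K
    · rw [h1 hyK, hgy]; simp
    · rw [hgy, h0 y hy hyK, mul_zero]

namespace HaarSystem

variable {G X : Type*} [TopologicalSpace G] [TopologicalSpace X] [MeasurableSpace G]
  {𝒢 : TopGroupoid G X} (H : HaarSystem 𝒢)

instance (x : X) : IsFiniteMeasureOnCompacts (H.meas x) := H.finite_on_compacts x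

theorem ae_src [SecondCountableTopology G] (x : X) : ∀ᵐ γ ∂(H.meas x), 𝒢.src γ = x := by
  have := Measure.support_mem_ae (μ := H.meas x)
  rwa [H.support_eq] at this

set_option linter.unusedSectionVars false

variable [T2Space G] [LocallyCompactSpace G] [SecondCountableTopology G] [BorelSpace G]

theorem integrable_of_continuousOn (x : X) {K : Set G} (hK : IsCompact K) {F : G → ℂ}
    (hF : ContinuousOn F {γ | 𝒢.src γ = x}) (h0 : ∀ γ, 𝒢.src γ = x → γ ∉ K → F γ = 0) :
    Integrable F (H.meas x) := by
  obtain ⟨f, hf⟩ := exists_compactlySupported_eqOn (𝒢.isClosed_fibre x) hK hF h0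
  exact (f.continuous.integrable_of_hasCompactSupport f.hasCompactSupport).congr
    ((H.ae_src x).mono fun γ hγ => hf hγ)

theorem invariant_of_continuousOn (η : G) {K : Set G} (hK : IsCompact K) {F : G → ℂ}
    (hF : ContinuousOn F {γ | 𝒢.src γ = 𝒢.src η})
    (h0 : ∀ γ, 𝒢.src γ = 𝒢.src η → γ ∉ K → F γ = 0) :
    ∫ γ, F (𝒢.mul γ η) ∂(H.meas (𝒢.rng η)) = ∫ γ, F γ ∂(H.meas (𝒢.src η)) := by
  obtain ⟨f, hf⟩ := exists_compactlySupported_eqOn (𝒢.isClosed_fibre _) hK hF h0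
  have h := H.invariant η f
  rw [integral_congr_ae ((H.ae_src _).mono fun γ hγ => hf hγ)] at h
  rw [← h]
  refine integral_congr_ae ((H.ae_src _).mono fun γ hγ => (hf ?_).symm)
  exact 𝒢.src_mul _ _ hγ

theorem swap_of_continuousOn (x y : X) {K : Set (G × G)} (hK : IsCompact K) {F : G → G → ℂ}
    (hF : ContinuousOn (fun p : G × G => F p.1 p.2) {p | 𝒢.src p.1 = x ∧ 𝒢.src p.2 = y})
    (h0 : ∀ a b, 𝒢.src a = x → 𝒢.src b = y → (a, b) ∉ K → F a b = 0) :
    ∫ a, ∫ b, F a b ∂(H.meas y) ∂(H.meas x) = ∫ b, ∫ a, F a b ∂(H.meas x) ∂(H.meas y) := by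
  have hC : IsClosed {p : G × G | 𝒢.src p.1 = x ∧ 𝒢.src p.2 = y} :=
    ((𝒢.isClosed_fibre x).preimage continuous_fst).inter
      ((𝒢.isClosed_fibre y).preimage continuous_snd)
  obtain ⟨f, hf⟩ := exists_compactlySupported_eqOn hC hK hF (fun p hp => h0 p.1 p.2 hp.1 hp.2)
  have h := integral_integral_swap_of_hasCompactSupport (f := fun a b => f (a, b))
    (μ := H.meas x) (ν := H.meas y) f.continuous f.hasCompactSupport
  calc _ = ∫ a, ∫ b, f (a, b) ∂(H.meas y) ∂(H.meas x) :=
        integral_congr_ae ((H.ae_src x).mono fun a ha =>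
          integral_congr_ae ((H.ae_src y).mono fun b hb => (hf (x := (a, b)) ⟨ha, hb⟩).symm))
    _ = _ := h
    _ = _ := integral_congr_ae ((H.ae_src y).mono fun b hb =>
          integral_congr_ae ((H.ae_src x).mono fun a ha => hf (x := (a, b)) ⟨ha, hb⟩))

theorem continuous_integral_param {Y : Type*} [TopologicalSpace Y] [T2Space Y]
    [LocallyCompactSpace Y] [SecondCountableTopology Y] {p : Y → X} (hp : Continuous p)
    {K : Set G} (hK : IsCompact K) {F : Y → G → ℂ}
    (hF : ContinuousOn (fun q : Y × G => F q.1 q.2) {q | 𝒢.src q.2 = p q.1})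
    (h0 : ∀ y γ, 𝒢.src γ = p y → γ ∉ K → F y γ = 0) :
    Continuous fun y => ∫ γ, F y γ ∂(H.meas (p y)) := by
  have := 𝒢.t2Space
  have hC : IsClosed {q : Y × G | 𝒢.src q.2 = p q.1} :=
    isClosed_eq (𝒢.continuous_src.comp continuous_snd) (hp.comp continuous_fst)
  obtain ⟨g, hg⟩ := ContinuousMap.exists_restrict_eq hC
    ⟨Set.domRestrict _ (fun q : Y × G => F q.1 q.2), hF.domRestrict⟩
  have hgF : ∀ y γ, 𝒢.src γ = p y → g (y, γ) = F y γ := fun y γ h =>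
    congrArg (fun f : C({q : Y × G | 𝒢.src q.2 = p q.1}, ℂ) => f ⟨(y, γ), h⟩) hg
  obtain ⟨χ, h1, -, hχ, -⟩ := exists_continuous_one_zero_of_isCompact hK isClosed_empty
    (Set.disjoint_empty K)
  obtain ⟨ψ, hψ1, -, hψ, hψ0⟩ := exists_continuous_one_zero_of_isCompact hχ isClosed_empty
    (Set.disjoint_empty _)
  -- the extended integrand
  let f : Y → C_c(G, ℂ) := fun y => ⟨⟨fun γ => (χ γ : ℂ) * g (y, γ), by fun_prop⟩,
    HasCompactSupport.mul_right (hχ.comp_left (g := ((↑) : ℝ → ℂ)) Complex.ofReal_zero)⟩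
  have hfdef : ∀ y γ, f y γ = (χ γ : ℂ) * g (y, γ) := fun _ _ => rfl
  have hFf : ∀ y, ∫ γ, F y γ ∂(H.meas (p y)) = ∫ γ, f y γ ∂(H.meas (p y)) := fun y => by
    refine integral_congr_ae ((H.ae_src (p y)).mono fun γ hγ => ?_)
    rw [hfdef, hgF y γ hγ]
    by_cases hyK : γ ∈ K
    · rw [h1 hyK]; simp
    · rw [h0 y γ hγ hyK, mul_zero]
  simp_rw [hFf]
  have hψint : ∀ x, Integrable ψ (H.meas x) := fun x =>
    ψ.continuous.integrable_of_hasCompactSupport hψ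
  have hψcont : Continuous fun x => ∫ γ, ψ γ ∂(H.meas x) := by
    have h := H.continuous_integral ⟨⟨fun γ => (ψ γ : ℂ), by fun_prop⟩,
      hψ.comp_left (g := ((↑) : ℝ → ℂ)) Complex.ofReal_zero⟩
    have h' : Continuous fun x => ((∫ γ, ψ γ ∂(H.meas x) : ℝ) : ℂ) := by
      refine h.congr fun x => ?_
      exact integral_ofReal
    exact (Complex.continuous_re.comp h')
  have hfint : ∀ y x, Integrable (f y) (H.meas x) := fun y x =>
    (f y).continuous.integrable_of_hasCompactSupport (f y).hasCompactSupport
  rw [continuous_iff_continuousAt]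
  intro y₀
  have hA : Tendsto (fun y => ∫ γ, f y₀ γ ∂(H.meas (p y))) (𝓝 y₀)
      (𝓝 (∫ γ, f y₀ γ ∂(H.meas (p y₀)))) :=
    ((H.continuous_integral (f y₀)).comp hp).tendsto y₀
  have hB : Tendsto (fun y => ∫ γ, f y γ ∂(H.meas (p y)) - ∫ γ, f y₀ γ ∂(H.meas (p y))) (𝓝 y₀)
      (𝓝 0) := by
    let Φ : C(Y, C(G, ℂ)) := ContinuousMap.curry ⟨fun q : Y × G => (χ q.2 : ℂ) * g q, by fun_prop⟩
    have hΦ := ContinuousMap.tendsto_iff_forall_isCompact_tendstoUniformlyOn.1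
      (Φ.continuous.tendsto y₀) (tsupport χ) hχ
    set M := ∫ γ, ψ γ ∂(H.meas (p y₀)) with hM
    have hM0 : 0 ≤ M := integral_nonneg fun γ => (hψ0 γ).1
    have hMev : ∀ᶠ y in 𝓝 y₀, ∫ γ, ψ γ ∂(H.meas (p y)) < M + 1 :=
      ((hψcont.comp hp).tendsto y₀).eventually (gt_mem_nhds (lt_add_one M))
    rw [Metric.tendsto_nhds]
    intro ε hε
    have hδ : 0 < ε / (M + 1) := by positivity
    filter_upwards [Metric.tendstoUniformlyOn_iff.1 hΦ _ hδ, hMev] with y hy hyM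
    rw [dist_zero_right, ← integral_sub (hfint _ _) (hfint _ _)]
    calc ‖∫ γ, (f y γ - f y₀ γ) ∂(H.meas (p y))‖
        ≤ ∫ γ, ε / (M + 1) * ψ γ ∂(H.meas (p y)) := by
          refine norm_integral_le_of_norm_le ((hψint _).const_mul _) (Eventually.of_forall ?_)
          intro γ
          by_cases hγ : γ ∈ tsupport χ
          · have := hy γ hγ
            rw [dist_comm, dist_eq_norm] at this
            rw [hψ1 hγ, Pi.one_apply, mul_one]
            exact this.le
          · have : χ γ = 0 := image_eq_zero_of_notMem_tsupport hγ
            rw [hfdef, hfdef, this]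
            simpa using mul_nonneg hδ.le (hψ0 γ).1
      _ = ε / (M + 1) * ∫ γ, ψ γ ∂(H.meas (p y)) := integral_const_mul _ _
      _ < ε / (M + 1) * (M + 1) := by gcongr
      _ = ε := by field_simp
  have hAB := hB.add hA
  simp only [sub_add_cancel, zero_add] at hAB
  exact hAB

end HaarSystem

/-! ## The twisted groupoid `𝒢_σ` and its Haar system -/

noncomputable instance : MeasurableSpace Circle := borel Circle
instance : BorelSpace Circle := ⟨rfl⟩

/-- Normalized Lebesgue (= Haar probability) measure on the circle. -/
noncomputable def circleMeasure : Measure Circle := Measure.haarMeasure ⊤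

instance : circleMeasure.IsHaarMeasure := by unfold circleMeasure; infer_instance

instance : IsProbabilityMeasure circleMeasure :=
  ⟨by simpa [circleMeasure] using Measure.haarMeasure_self (G := Circle) (K₀ := ⊤)⟩

section Twist

variable {G X : Type*} [TopologicalSpace G] [TopologicalSpace X] {𝒢 : TopGroupoid G X}

theorem GroupoidCocycle.inv_symm (σ : GroupoidCocycle 𝒢) (a : G) :
    σ (𝒢.inv a) a = σ a (𝒢.inv a) := by
  have h := σ.cocycle a (𝒢.inv a) a (𝒢.rng_inv a).symm (𝒢.src_inv a)
  rw [𝒢.mul_inv, 𝒢.inv_mul, σ.unit_left, σ.unit_right, mul_one, mul_one] at h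
  exact h.symm

/-- The twisted groupoid `𝒢_σ`: arrows `G × 𝕋` with the product topology, product
`(γ₁, z₁)(γ₂, z₂) = (γ₁γ₂, z₁ z₂ conj σ(γ₁, γ₂))`, inverse
`(γ, z)⁻¹ = (γ⁻¹, conj z σ(γ, γ⁻¹))`. On the circle, conjugation is `z ↦ z⁻¹`. -/
noncomputable def TopGroupoid.twist (𝒢 : TopGroupoid G X) (σ : GroupoidCocycle 𝒢) :
    TopGroupoid (G × Circle) X where
  src p := 𝒢.src p.1
  rng p := 𝒢.rng p.1
  unit x := (𝒢.unit x, 1)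
  inv p := (𝒢.inv p.1, p.2⁻¹ * σ p.1 (𝒢.inv p.1))
  mul p q := (𝒢.mul p.1 q.1, p.2 * q.2 * (σ p.1 q.1)⁻¹)
  src_unit := 𝒢.src_unit
  rng_unit := 𝒢.rng_unit
  src_inv p := 𝒢.src_inv p.1
  rng_inv p := 𝒢.rng_inv p.1
  src_mul p q := 𝒢.src_mul p.1 q.1
  rng_mul p q := 𝒢.rng_mul p.1 q.1
  mul_assoc a b c hab hbc := by
    refine Prod.ext (𝒢.mul_assoc _ _ _ hab hbc) ?_
    have h := σ.cocycle a.1 b.1 c.1 hab hbc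
    have h' : (σ a.1 b.1)⁻¹ * (σ (𝒢.mul a.1 b.1) c.1)⁻¹ =
        (σ b.1 c.1)⁻¹ * (σ a.1 (𝒢.mul b.1 c.1))⁻¹ := by rw [← _root_.mul_inv, h, _root_.mul_inv]
    calc a.2 * b.2 * (σ a.1 b.1)⁻¹ * c.2 * (σ (𝒢.mul a.1 b.1) c.1)⁻¹
        = a.2 * b.2 * c.2 * ((σ a.1 b.1)⁻¹ * (σ (𝒢.mul a.1 b.1) c.1)⁻¹) := by
          simp only [_root_.mul_assoc, _root_.mul_comm, _root_.mul_left_comm]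
      _ = a.2 * (b.2 * c.2 * (σ b.1 c.1)⁻¹) * (σ a.1 (𝒢.mul b.1 c.1))⁻¹ := by
          rw [h']; simp only [_root_.mul_assoc]
  unit_mul p := Prod.ext (𝒢.unit_mul p.1) (by simp [σ.unit_left])
  mul_unit p := Prod.ext (𝒢.mul_unit p.1) (by simp [σ.unit_right])
  inv_mul p := Prod.ext (𝒢.inv_mul p.1) (by simp [σ.inv_symm, mul_right_comm])
  mul_inv p := Prod.ext (𝒢.mul_inv p.1) (by simp)
  continuous_src := 𝒢.continuous_src.comp continuous_fst
  continuous_rng := 𝒢.continuous_rng.comp continuous_fst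
  continuous_unit := 𝒢.continuous_unit.prodMk continuous_const
  continuous_inv := by
    have h : Continuous fun p : G × Circle => σ p.1 (𝒢.inv p.1) :=
      σ.continuousOn.comp_continuous
        (continuous_fst.prodMk (𝒢.continuous_inv.comp continuous_fst))
        fun p => (𝒢.rng_inv p.1).symm
    exact (𝒢.continuous_inv.comp continuous_fst).prodMk (continuous_snd.inv.mul h)
  continuousOn_mul := by
    have hc : ContinuousOn (fun p : (G × Circle) × (G × Circle) => (p.1.1, p.2.1))
        {p | 𝒢.src p.1.1 = 𝒢.rng p.2.1} := by fun_prop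
    refine (𝒢.continuousOn_mul.comp hc fun p hp => hp).prodMk
      (ContinuousOn.mul (by fun_prop) ?_)
    exact (σ.continuousOn.comp hc fun p hp => hp).inv

end Twist

section TwistHaar

set_option linter.unusedSectionVars false

variable {G X : Type*} [TopologicalSpace G] [TopologicalSpace X] [MeasurableSpace G]
  {𝒢 : TopGroupoid G X} [T2Space G] [LocallyCompactSpace G] [SecondCountableTopology G]
  [BorelSpace G]

theorem continuous_circle_integral (f : C_c(G × Circle, ℂ)) :
    Continuous fun γ => ∫ z, f (γ, z) ∂circleMeasure := by
  have := continuous_parametric_integral_of_continuous (μ := circleMeasure)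
    (f := fun γ z => f (γ, z)) (s := Set.univ) (by exact f.continuous) isCompact_univ
  simpa using this

theorem hasCompactSupport_circle_integral (f : C_c(G × Circle, ℂ)) :
    HasCompactSupport fun γ => ∫ z, f (γ, z) ∂circleMeasure := by
  refine HasCompactSupport.intro (K := Prod.fst '' tsupport f)
    (f.hasCompactSupport.image continuous_fst) fun γ hγ => ?_
  refine integral_eq_zero_of_ae (Eventually.of_forall fun z => ?_)
  refine image_eq_zero_of_notMem_tsupport (f := f) fun h => hγ ⟨_, h, rfl⟩

/-- The Haar system `{λ_x × η}` of `𝒢_σ`. -/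
noncomputable def HaarSystem.twist (H : HaarSystem 𝒢) (σ : GroupoidCocycle 𝒢) :
    HaarSystem (𝒢.twist σ) where
  meas x := (H.meas x).prod circleMeasure
  finite_on_compacts x := inferInstance
  support_eq x := by
    rw [Measure.support_eq_forall_isOpen]
    ext ⟨γ, z⟩
    simp only [Set.mem_ofPred_eq]
    constructor
    · intro h
      by_contra hγ
      have hγ' : 𝒢.src γ ≠ x := hγ
      have hU : IsOpen ({γ | 𝒢.src γ = x}ᶜ : Set G) := (𝒢.isClosed_fibre x).isOpen_compl
      have := h ({γ | 𝒢.src γ = x}ᶜ ×ˢ Set.univ) ⟨hγ', trivial⟩ (hU.prod isOpen_univ)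
      rw [Measure.prod_prod] at this
      have h0 : H.meas x {γ | 𝒢.src γ = x}ᶜ = 0 := H.ae_src x
      simp [h0] at this
    · intro hγ U hmem hU
      obtain ⟨V, W, hV, hW, hγV, hzW, hVW⟩ := isOpen_prod_iff.1 hU γ z hmem
      have hγ' : γ ∈ (H.meas x).support := by rw [H.support_eq]; exact hγ
      rw [Measure.support_eq_forall_isOpen] at hγ'
      refine lt_of_lt_of_le ?_ (measure_mono hVW)
      rw [Measure.prod_prod]
      exact ENNReal.mul_pos (hγ' V hγV hV).ne' (hW.measure_pos _ ⟨z, hzW⟩).ne'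
  continuous_integral f := by
    have h := H.continuous_integral ⟨⟨_, continuous_circle_integral f⟩,
      hasCompactSupport_circle_integral f⟩
    refine h.congr fun x => ?_
    exact (integral_prod _ (f.continuous.integrable_of_hasCompactSupport f.hasCompactSupport)).symm
  invariant η f := by
    rcases η with ⟨η, w⟩
    let F : C_c(G, ℂ) := ⟨⟨_, continuous_circle_integral f⟩, hasCompactSupport_circle_integral f⟩
    have hR : ∫ p, f p ∂((H.meas (𝒢.src η)).prod circleMeasure) =
        ∫ γ, F γ ∂(H.meas (𝒢.src η)) :=
      integral_prod _ (f.continuous.integrable_of_hasCompactSupport f.hasCompactSupport)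
    have hcl : IsClosed {p : G × Circle | 𝒢.src p.1 = 𝒢.rng η} :=
      (𝒢.isClosed_fibre (𝒢.rng η)).preimage continuous_fst
    have hae : ∀ᵐ p ∂((H.meas (𝒢.rng η)).prod circleMeasure), 𝒢.src p.1 = 𝒢.rng η :=
      Measure.quasiMeasurePreserving_fst.ae (H.ae_src (𝒢.rng η))
    have hint : Integrable (fun p : G × Circle => f ((𝒢.twist σ).mul p (η, w)))
        ((H.meas (𝒢.rng η)).prod circleMeasure) := by
      have hcont : ContinuousOn (fun p : G × Circle => f ((𝒢.twist σ).mul p (η, w)))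
          {p : G × Circle | 𝒢.src p.1 = 𝒢.rng η} :=
        f.continuous.comp_continuousOn ((𝒢.twist σ).continuousOn_mul.comp
          (f := fun p : G × Circle => (p, ((η, w) : G × Circle))) (by fun_prop) fun p hp => hp)
      have hK : IsCompact ((𝒢.mulSet (Prod.fst '' tsupport f) {𝒢.inv η}) ×ˢ
          (Set.univ : Set Circle)) :=
        (𝒢.isCompact_mulSet (f.hasCompactSupport.image continuous_fst) isCompact_singleton).prod
          isCompact_univ
      obtain ⟨g, hg⟩ := exists_compactlySupported_eqOn hcl hK hcont (by
        intro p hp hpK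
        refine image_eq_zero_of_notMem_tsupport (f := f) fun h => hpK ⟨?_, trivial⟩
        have hp' : 𝒢.src p.1 = 𝒢.rng η := hp
        refine 𝒢.mem_mulSet_of_div (b := 𝒢.inv η) (by rw [hp', 𝒢.src_inv]) ?_ rfl
        rw [𝒢.inv_inv]
        exact ⟨_, h, rfl⟩)
      exact (g.continuous.integrable_of_hasCompactSupport g.hasCompactSupport).congr
        (hae.mono fun p hp => hg hp)
    change ∫ p, f ((𝒢.twist σ).mul p (η, w)) ∂((H.meas (𝒢.rng η)).prod circleMeasure) =
      ∫ p, f p ∂((H.meas (𝒢.src η)).prod circleMeasure)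
    rw [hR, integral_prod _ hint, ← H.invariant η F]
    congr 1 with γ
    change ∫ z, f (𝒢.mul γ η, z * w * (σ γ η)⁻¹) ∂circleMeasure =
      ∫ z, f (𝒢.mul γ η, z) ∂circleMeasure
    simp_rw [mul_assoc]
    exact integral_mul_right_eq_self (fun z => f (𝒢.mul γ η, z)) _

end TwistHaar

/-! ## The twisted convolution algebra `C_c(𝒢, σ)` -/

section Convolution

set_option linter.unusedSectionVars false

variable {G X : Type*} [TopologicalSpace G] [TopologicalSpace X] [MeasurableSpace G]
  {𝒢 : TopGroupoid G X} [T2Space G] [LocallyCompactSpace G] [SecondCountableTopology G]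
  [BorelSpace G]

theorem circle_continuous_coe : Continuous ((↑) : Circle → ℂ) := continuous_subtype_val

theorem GroupoidCocycle.continuousOn_div (σ : GroupoidCocycle 𝒢) :
    ContinuousOn (fun p : G × G => (σ (𝒢.mul p.1 (𝒢.inv p.2)) p.2 : ℂ))
      {p | 𝒢.src p.1 = 𝒢.src p.2} :=
  circle_continuous_coe.comp_continuousOn (σ.continuousOn.comp
    (𝒢.continuousOn_div.prodMk continuousOn_snd) fun _ hp => 𝒢.src_div hp)

/-- The `σ`-twisted convolution as a function:
`(f ⋆ g)(γ) = ∫_{G_{s(γ)}} f(γμ⁻¹) g(μ) σ(γμ⁻¹, μ) dλ_{s(γ)}(μ)`. -/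
noncomputable def twistedConv (H : HaarSystem 𝒢) (σ : GroupoidCocycle 𝒢) (f g : G → ℂ) (γ : G) :
    ℂ :=
  ∫ μ, f (𝒢.mul γ (𝒢.inv μ)) * g μ * (σ (𝒢.mul γ (𝒢.inv μ)) μ : ℂ) ∂(H.meas (𝒢.src γ))

/-- The `σ`-twisted involution as a function: `f*(γ) = conj σ(γ⁻¹, γ) conj f(γ⁻¹)`. -/
noncomputable def twistedInvol (σ : GroupoidCocycle 𝒢) (f : G → ℂ) (γ : G) : ℂ :=
  conj (σ (𝒢.inv γ) γ : ℂ) * conj (f (𝒢.inv γ))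

/-- The `I`-norm
`sup_x max {∫_{G_x} |f(γ)| dλ_x(γ), ∫_{G_x} |f(γ⁻¹)| dλ_x(γ)}`. -/
noncomputable def iNorm (H : HaarSystem 𝒢) (f : G → ℂ) : ℝ :=
  ⨆ x : X, max (∫ γ, ‖f γ‖ ∂(H.meas x)) (∫ γ, ‖f (𝒢.inv γ)‖ ∂(H.meas x))

variable (H : HaarSystem 𝒢) (σ : GroupoidCocycle 𝒢)

theorem convIntegrand_continuousOn (f g : C_c(G, ℂ)) :
    ContinuousOn (fun p : G × G => f (𝒢.mul p.1 (𝒢.inv p.2)) * g p.2 *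
      (σ (𝒢.mul p.1 (𝒢.inv p.2)) p.2 : ℂ)) {p | 𝒢.src p.1 = 𝒢.src p.2} :=
  ((f.continuous.comp_continuousOn 𝒢.continuousOn_div).mul
    (g.continuous.comp_continuousOn continuousOn_snd)).mul σ.continuousOn_div

theorem convIntegrand_integrable (f g : C_c(G, ℂ)) (γ : G) :
    Integrable (fun μ => f (𝒢.mul γ (𝒢.inv μ)) * g μ * (σ (𝒢.mul γ (𝒢.inv μ)) μ : ℂ))
      (H.meas (𝒢.src γ)) := by
  refine H.integrable_of_continuousOn _ g.hasCompactSupport ?_ ?_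
  · exact (convIntegrand_continuousOn σ f g).comp (f := fun μ => (γ, μ)) (by fun_prop)
      fun μ hμ => Eq.symm hμ
  · intro μ _ hμ
    rw [image_eq_zero_of_notMem_tsupport hμ, mul_zero, zero_mul]

theorem continuous_twistedConv (f g : C_c(G, ℂ)) : Continuous (twistedConv H σ f g) := by
  refine H.continuous_integral_param 𝒢.continuous_src g.hasCompactSupport
    (F := fun γ μ => f (𝒢.mul γ (𝒢.inv μ)) * g μ * (σ (𝒢.mul γ (𝒢.inv μ)) μ : ℂ)) ?_ ?_
  · exact (convIntegrand_continuousOn σ f g).mono fun p hp => Eq.symm hp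
  · intro γ μ _ hμ
    rw [image_eq_zero_of_notMem_tsupport hμ, mul_zero, zero_mul]

theorem hasCompactSupport_twistedConv (f g : C_c(G, ℂ)) :
    HasCompactSupport (twistedConv H σ f g) := by
  refine HasCompactSupport.intro (𝒢.isCompact_mulSet f.hasCompactSupport g.hasCompactSupport)
    fun γ hγ => ?_
  refine integral_eq_zero_of_ae ((H.ae_src _).mono fun μ hμ => ?_)
  by_cases hg : μ ∈ tsupport g
  · have hf : 𝒢.mul γ (𝒢.inv μ) ∉ tsupport f := fun hf =>
      hγ (𝒢.mem_mulSet_of_div (Eq.symm hμ) hf hg)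
    simp [image_eq_zero_of_notMem_tsupport hf]
  · simp [image_eq_zero_of_notMem_tsupport hg]

theorem continuous_twistedInvol (f : C_c(G, ℂ)) : Continuous (twistedInvol σ f) := by
  have h : Continuous fun γ => (σ (𝒢.inv γ) γ : ℂ) :=
    circle_continuous_coe.comp (σ.continuousOn.comp_continuous
      (𝒢.continuous_inv.prodMk continuous_id) fun γ => 𝒢.src_inv γ)
  exact (Complex.continuous_conj.comp h).mul
    (Complex.continuous_conj.comp (f.continuous.comp 𝒢.continuous_inv))

theorem TopGroupoid.hasCompactSupport_comp_inv (f : C_c(G, ℂ)) :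
    HasCompactSupport fun γ => f (𝒢.inv γ) := by
  refine HasCompactSupport.intro (K := 𝒢.inv '' tsupport f)
    (f.hasCompactSupport.image 𝒢.continuous_inv) fun γ hγ => ?_
  exact image_eq_zero_of_notMem_tsupport fun h => hγ ⟨_, h, 𝒢.inv_inv γ⟩

theorem hasCompactSupport_twistedInvol (f : C_c(G, ℂ)) :
    HasCompactSupport (twistedInvol σ f) :=
  HasCompactSupport.mul_left ((𝒢.hasCompactSupport_comp_inv f).comp_left (g := conj) (map_zero _))

/-- The convolution at `γ μ⁻¹`, after right translation by `μ`. -/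
theorem twistedConv_div (f g : C_c(G, ℂ)) {γ μ : G} (h : 𝒢.src γ = 𝒢.src μ) :
    twistedConv H σ f g (𝒢.mul γ (𝒢.inv μ)) =
      ∫ ν, f (𝒢.mul γ (𝒢.inv ν)) * g (𝒢.mul ν (𝒢.inv μ)) *
        (σ (𝒢.mul γ (𝒢.inv ν)) (𝒢.mul ν (𝒢.inv μ)) : ℂ) ∂(H.meas (𝒢.src μ)) := by
  have hdγ : ContinuousOn (fun ν => 𝒢.mul γ (𝒢.inv ν)) {ν | 𝒢.src ν = 𝒢.src μ} :=
    𝒢.continuousOn_div.comp (f := fun ν => (γ, ν)) (by fun_prop) fun ν hν => h.trans (Eq.symm hν)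
  have hdμ : ContinuousOn (fun ν => 𝒢.mul ν (𝒢.inv μ)) {ν | 𝒢.src ν = 𝒢.src μ} :=
    𝒢.continuousOn_div.comp (f := fun ν => (ν, μ)) (by fun_prop) fun ν hν => hν
  have hinv := H.invariant_of_continuousOn μ
    (𝒢.isCompact_mulSet g.hasCompactSupport (isCompact_singleton (x := μ)))
    (F := fun ν => f (𝒢.mul γ (𝒢.inv ν)) * g (𝒢.mul ν (𝒢.inv μ)) *
        (σ (𝒢.mul γ (𝒢.inv ν)) (𝒢.mul ν (𝒢.inv μ)) : ℂ))
    (((f.continuous.comp_continuousOn hdγ).mul (g.continuous.comp_continuousOn hdμ)).mul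
      (circle_continuous_coe.comp_continuousOn (σ.continuousOn.comp (hdγ.prodMk hdμ) fun ν hν => by
        have hν' : 𝒢.src ν = 𝒢.src μ := hν
        change 𝒢.src (𝒢.mul γ (𝒢.inv ν)) = 𝒢.rng (𝒢.mul ν (𝒢.inv μ))
        rw [𝒢.src_div (h.trans hν'.symm), 𝒢.rng_div hν'])))
    (fun ν hν hνK => by
      have : 𝒢.mul ν (𝒢.inv μ) ∉ tsupport g := fun hg =>
        hνK (𝒢.mem_mulSet_of_div hν hg rfl)
      rw [image_eq_zero_of_notMem_tsupport this, mul_zero, zero_mul])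
  rw [← hinv, twistedConv, 𝒢.src_div h]
  refine integral_congr_ae ((H.ae_src _).mono fun ν hν => ?_)
  have e2 : 𝒢.mul (𝒢.mul ν μ) (𝒢.inv μ) = ν := 𝒢.mul_inv_cancel_right hν
  have e1 : 𝒢.mul γ (𝒢.inv (𝒢.mul ν μ)) = 𝒢.mul (𝒢.mul γ (𝒢.inv μ)) (𝒢.inv ν) := by
    have := 𝒢.div_div_div (a := γ) (b := 𝒢.mul ν μ) (c := μ)
      (h.trans (𝒢.src_mul _ _ hν).symm) (𝒢.src_mul _ _ hν)
    rw [← this, e2]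
  simp only [e1, e2]

theorem twistedConv_assoc (f g h fg gh : C_c(G, ℂ)) (hfg : ∀ γ, fg γ = twistedConv H σ f g γ)
    (hgh : ∀ γ, gh γ = twistedConv H σ g h γ) (γ : G) :
    twistedConv H σ fg h γ = twistedConv H σ f gh γ := by
  set x := 𝒢.src γ with hx
  have hL : twistedConv H σ fg h γ = ∫ μ, ∫ ν, f (𝒢.mul γ (𝒢.inv ν)) * g (𝒢.mul ν (𝒢.inv μ)) *
        (σ (𝒢.mul γ (𝒢.inv ν)) (𝒢.mul ν (𝒢.inv μ)) : ℂ) * (h μ * (σ (𝒢.mul γ (𝒢.inv μ)) μ : ℂ))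
        ∂(H.meas x) ∂(H.meas x) := by
    refine integral_congr_ae ((H.ae_src _).mono fun μ hμ => ?_)
    have hμ' : 𝒢.src μ = x := hμ
    simp only [integral_mul_const]
    rw [hfg, twistedConv_div H σ f g (hx.symm.trans hμ'.symm), hμ', mul_assoc]
  have hR : twistedConv H σ f gh γ = ∫ ν, ∫ μ, f (𝒢.mul γ (𝒢.inv ν)) * g (𝒢.mul ν (𝒢.inv μ)) *
        (σ (𝒢.mul γ (𝒢.inv ν)) (𝒢.mul ν (𝒢.inv μ)) : ℂ) * (h μ * (σ (𝒢.mul γ (𝒢.inv μ)) μ : ℂ))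
        ∂(H.meas x) ∂(H.meas x) := by
    refine integral_congr_ae ((H.ae_src _).mono fun ν hν => ?_)
    have hν' : 𝒢.src ν = x := hν
    simp only
    rw [hgh, twistedConv, ← integral_const_mul, ← integral_mul_const, hν']
    refine integral_congr_ae ((H.ae_src _).mono fun μ hμ => ?_)
    have hμ' : 𝒢.src μ = x := hμ
    have hc := σ.cocycle (𝒢.mul γ (𝒢.inv ν)) (𝒢.mul ν (𝒢.inv μ)) μ
      (by rw [𝒢.src_div (hx.symm.trans hν'.symm), 𝒢.rng_div (hν'.trans hμ'.symm)])
      (𝒢.src_div (hν'.trans hμ'.symm))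
    rw [𝒢.div_mul_div (hx.symm.trans hν'.symm) (hν'.trans hμ'.symm),
      𝒢.inv_mul_cancel_right (hν'.trans hμ'.symm)] at hc
    have hc' := congrArg ((↑) : Circle → ℂ) hc
    simp only [Circle.coe_mul] at hc'
    simp only
    linear_combination (-(f (𝒢.mul γ (𝒢.inv ν)) * g (𝒢.mul ν (𝒢.inv μ)) * h μ)) * hc'
  rw [hL, hR]
  have hmaps : ∀ p ∈ {p : G × G | 𝒢.src p.1 = x ∧ 𝒢.src p.2 = x}, 𝒢.src p.2 = 𝒢.src p.1 :=
    fun p hp => hp.2.trans hp.1.symm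
  have d1 : ContinuousOn (fun p : G × G => 𝒢.mul γ (𝒢.inv p.2))
      {p : G × G | 𝒢.src p.1 = x ∧ 𝒢.src p.2 = x} :=
    𝒢.continuousOn_div.comp (f := fun p : G × G => (γ, p.2)) (by fun_prop) fun p hp => hp.2.symm
  have d2 : ContinuousOn (fun p : G × G => 𝒢.mul γ (𝒢.inv p.1))
      {p : G × G | 𝒢.src p.1 = x ∧ 𝒢.src p.2 = x} :=
    𝒢.continuousOn_div.comp (f := fun p : G × G => (γ, p.1)) (by fun_prop) fun p hp => hp.1.symm
  have d3 : ContinuousOn (fun p : G × G => 𝒢.mul p.2 (𝒢.inv p.1))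
      {p : G × G | 𝒢.src p.1 = x ∧ 𝒢.src p.2 = x} :=
    𝒢.continuousOn_div.comp (f := fun p : G × G => (p.2, p.1)) (by fun_prop) hmaps
  refine H.swap_of_continuousOn x x
    (h.hasCompactSupport.prod (𝒢.isCompact_mulSet g.hasCompactSupport h.hasCompactSupport)) ?_ ?_
  · refine (((f.continuous.comp_continuousOn d1).mul (g.continuous.comp_continuousOn d3)).mul
      (circle_continuous_coe.comp_continuousOn (σ.continuousOn.comp (d1.prodMk d3) ?_))).mul
      ((h.continuous.comp_continuousOn continuousOn_fst).mul
      (circle_continuous_coe.comp_continuousOn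
        (σ.continuousOn.comp (d2.prodMk continuousOn_fst) ?_)))
    · intro p hp
      change 𝒢.src (𝒢.mul γ (𝒢.inv p.2)) = 𝒢.rng (𝒢.mul p.2 (𝒢.inv p.1))
      rw [𝒢.src_div (hx.symm.trans hp.2.symm), 𝒢.rng_div (hmaps p hp)]
    · intro p hp
      exact 𝒢.src_div (hx.symm.trans hp.1.symm)
  · intro μ ν hμ hν hK
    by_cases hh : μ ∈ tsupport h
    · have hg : 𝒢.mul ν (𝒢.inv μ) ∉ tsupport g := fun hg =>
        hK ⟨hh, 𝒢.mem_mulSet_of_div (hν.trans hμ.symm) hg hh⟩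
      rw [image_eq_zero_of_notMem_tsupport hg]; simp
    · rw [image_eq_zero_of_notMem_tsupport hh]; simp

theorem twistedInvol_invol (f fs : C_c(G, ℂ)) (hfs : ∀ γ, fs γ = twistedInvol σ f γ) (γ : G) :
    twistedInvol σ fs γ = f γ := by
  have h1 : conj (σ (𝒢.inv γ) γ : ℂ) * (σ (𝒢.inv γ) γ : ℂ) = 1 := by
    rw [← Circle.coe_inv_eq_conj, ← Circle.coe_mul, inv_mul_cancel, Circle.coe_one]
  rw [twistedInvol, hfs, twistedInvol, 𝒢.inv_inv, ← σ.inv_symm]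
  simp only [map_mul, Complex.conj_conj]
  rw [← mul_assoc, h1, one_mul]

theorem twistedInvol_conv (f g fs gs fg : C_c(G, ℂ)) (hfs : ∀ γ, fs γ = twistedInvol σ f γ)
    (hgs : ∀ γ, gs γ = twistedInvol σ g γ) (hfg : ∀ γ, fg γ = twistedConv H σ f g γ) (γ : G) :
    twistedInvol σ fg γ = twistedConv H σ gs fs γ := by
  have hsu : 𝒢.src (𝒢.unit (𝒢.src γ)) = 𝒢.src γ := 𝒢.src_unit _
  have hu : ∀ ν, 𝒢.src ν = 𝒢.src γ → 𝒢.mul (𝒢.unit (𝒢.src γ)) (𝒢.inv ν) = 𝒢.inv ν := by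
    intro ν hν
    have := 𝒢.unit_mul (𝒢.inv ν)
    rwa [𝒢.rng_inv, hν] at this
  rw [twistedInvol, hfg, ← hu γ rfl, twistedConv_div H σ f g hsu, hu γ rfl, ← integral_conj,
    ← integral_const_mul, twistedConv]
  refine integral_congr_ae ((H.ae_src _).mono fun ν hν => ?_)
  have hν' : 𝒢.src ν = 𝒢.src γ := hν
  simp only
  rw [hu ν hν', hgs, hfs, twistedInvol, twistedInvol, 𝒢.inv_div hν'.symm]
  have c1 := σ.cocycle (𝒢.inv ν) (𝒢.mul ν (𝒢.inv γ)) γ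
    (by rw [𝒢.src_inv, 𝒢.rng_div hν']) (𝒢.src_div hν')
  have e1 : 𝒢.mul (𝒢.inv ν) (𝒢.mul ν (𝒢.inv γ)) = 𝒢.inv γ :=
    𝒢.inv_mul_cancel_left (hν'.trans (𝒢.rng_inv γ).symm)
  rw [e1, 𝒢.inv_mul_cancel_right hν'] at c1
  have c2 := σ.cocycle (𝒢.mul ν (𝒢.inv γ)) (𝒢.mul γ (𝒢.inv ν)) ν
    (by rw [𝒢.src_div hν', 𝒢.rng_div hν'.symm]) (𝒢.src_div hν'.symm)
  rw [𝒢.div_mul_div hν' hν'.symm, 𝒢.inv_mul_cancel_right hν'.symm, 𝒢.mul_inv, σ.unit_left,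
    mul_one] at c2
  have key : (σ (𝒢.inv γ) γ)⁻¹ * (σ (𝒢.inv ν) (𝒢.mul ν (𝒢.inv γ)))⁻¹ =
      (σ (𝒢.mul ν (𝒢.inv γ)) (𝒢.mul γ (𝒢.inv ν)))⁻¹ * (σ (𝒢.inv ν) ν)⁻¹ *
        σ (𝒢.mul γ (𝒢.inv ν)) ν := by
    rw [← mul_inv, mul_comm (σ (𝒢.inv γ) γ), c1, c2, mul_inv, mul_inv]
    simp [mul_comm, mul_left_comm]
  have key' := congrArg ((↑) : Circle → ℂ) key
  simp only [Circle.coe_mul, Circle.coe_inv_eq_conj] at key'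
  simp only [map_mul]
  linear_combination (conj (f (𝒢.inv ν)) * conj (g (𝒢.mul ν (𝒢.inv γ)))) * key'

/-! ### The `I`-norm on `C_c` -/

theorem HaarSystem.continuous_integral_norm (f : C_c(G, ℂ)) :
    Continuous fun x => ∫ γ, ‖f γ‖ ∂(H.meas x) := by
  have h := H.continuous_integral ⟨⟨fun γ => (‖f γ‖ : ℂ), by fun_prop⟩,
    f.hasCompactSupport.comp_left (g := fun z : ℂ => (‖z‖ : ℂ)) (by simp)⟩
  have h' : Continuous fun x => ((∫ γ, ‖f γ‖ ∂(H.meas x) : ℝ) : ℂ) := by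
    refine h.congr fun x => ?_
    exact integral_ofReal
  exact Complex.continuous_re.comp h'

theorem HaarSystem.integrable_norm (f : C_c(G, ℂ)) (x : X) :
    Integrable (fun γ => ‖f γ‖) (H.meas x) :=
  (f.continuous.integrable_of_hasCompactSupport f.hasCompactSupport).norm

theorem HaarSystem.bddAbove_integral_norm (f : C_c(G, ℂ)) :
    BddAbove (Set.range fun x => ∫ γ, ‖f γ‖ ∂(H.meas x)) := by
  have hK : IsCompact (𝒢.src '' tsupport f) := f.hasCompactSupport.image 𝒢.continuous_src
  obtain ⟨M, hM⟩ := hK.bddAbove_image (H.continuous_integral_norm f).continuousOn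
  refine ⟨max M 0, ?_⟩
  rintro _ ⟨x, rfl⟩
  by_cases hx : x ∈ 𝒢.src '' tsupport f
  · exact le_max_of_le_left (hM ⟨x, hx, rfl⟩)
  · refine le_max_of_le_right (le_of_eq (integral_eq_zero_of_ae ((H.ae_src x).mono fun γ hγ => ?_)))
    have : γ ∉ tsupport f := fun h => hx ⟨γ, h, hγ⟩
    simp [image_eq_zero_of_notMem_tsupport this]

/-- `f ∘ inv` as a compactly supported function. -/
noncomputable def TopGroupoid.compInv (𝒢 : TopGroupoid G X) (f : C_c(G, ℂ)) : C_c(G, ℂ) :=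
  ⟨⟨fun γ => f (𝒢.inv γ), f.continuous.comp 𝒢.continuous_inv⟩, 𝒢.hasCompactSupport_comp_inv f⟩

theorem bddAbove_iNorm (f : C_c(G, ℂ)) : BddAbove (Set.range fun x : X =>
    max (∫ γ, ‖f γ‖ ∂(H.meas x)) (∫ γ, ‖f (𝒢.inv γ)‖ ∂(H.meas x))) := by
  obtain ⟨M, hM⟩ := H.bddAbove_integral_norm f
  obtain ⟨N, hN⟩ := H.bddAbove_integral_norm (𝒢.compInv f)
  refine ⟨max M N, ?_⟩
  rintro _ ⟨x, rfl⟩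
  exact max_le_max (hM ⟨x, rfl⟩) (hN ⟨x, rfl⟩)

theorem iNorm_nonneg (f : G → ℂ) : 0 ≤ iNorm H f :=
  Real.iSup_nonneg fun _ => le_max_of_le_left (integral_nonneg fun _ => norm_nonneg _)

theorem integral_norm_le_iNorm (f : C_c(G, ℂ)) (x : X) :
    ∫ γ, ‖f γ‖ ∂(H.meas x) ≤ iNorm H f :=
  (le_max_left _ _).trans (le_ciSup (bddAbove_iNorm H f) x)

theorem integral_norm_inv_le_iNorm (f : C_c(G, ℂ)) (x : X) :
    ∫ γ, ‖f (𝒢.inv γ)‖ ∂(H.meas x) ≤ iNorm H f :=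
  (le_max_right _ _).trans (le_ciSup (bddAbove_iNorm H f) x)

theorem iNorm_le (f : G → ℂ) {C : ℝ} (hC : 0 ≤ C) (h1 : ∀ x, ∫ γ, ‖f γ‖ ∂(H.meas x) ≤ C)
    (h2 : ∀ x, ∫ γ, ‖f (𝒢.inv γ)‖ ∂(H.meas x) ≤ C) : iNorm H f ≤ C :=
  Real.iSup_le (fun x => max_le (h1 x) (h2 x)) hC

theorem iNorm_add_le (f g : C_c(G, ℂ)) : iNorm H (fun γ => f γ + g γ) ≤ iNorm H f + iNorm H g := by
  have key : ∀ (f g : C_c(G, ℂ)) x, ∫ γ, ‖f γ + g γ‖ ∂(H.meas x) ≤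
      ∫ γ, ‖f γ‖ ∂(H.meas x) + ∫ γ, ‖g γ‖ ∂(H.meas x) := fun f g x => by
    rw [← integral_add (H.integrable_norm f x) (H.integrable_norm g x)]
    exact integral_mono (H.integrable_norm (f + g) x)
      ((H.integrable_norm f x).add (H.integrable_norm g x)) fun γ => norm_add_le _ _
  refine iNorm_le H _ (add_nonneg (iNorm_nonneg H f) (iNorm_nonneg H g)) (fun x => ?_) fun x => ?_
  · exact (key f g x).trans
      (add_le_add (integral_norm_le_iNorm H f x) (integral_norm_le_iNorm H g x))
  · exact (key (𝒢.compInv f) (𝒢.compInv g) x).trans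
      (add_le_add (integral_norm_inv_le_iNorm H f x) (integral_norm_inv_le_iNorm H g x))

theorem iNorm_smul_le (c : ℂ) (f : C_c(G, ℂ)) : iNorm H (fun γ => c * f γ) ≤ ‖c‖ * iNorm H f := by
  refine iNorm_le H _ (mul_nonneg (norm_nonneg c) (iNorm_nonneg H f)) (fun x => ?_) fun x => ?_
  · simp_rw [norm_mul, integral_const_mul]
    exact mul_le_mul_of_nonneg_left (integral_norm_le_iNorm H f x) (norm_nonneg c)
  · simp_rw [norm_mul, integral_const_mul]
    exact mul_le_mul_of_nonneg_left (integral_norm_inv_le_iNorm H f x) (norm_nonneg c)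

theorem norm_twistedInvol (f : G → ℂ) (γ : G) : ‖twistedInvol σ f γ‖ = ‖f (𝒢.inv γ)‖ := by
  simp [twistedInvol, Circle.norm_coe]

theorem iNorm_twistedInvol (f : G → ℂ) : iNorm H (twistedInvol σ f) = iNorm H f := by
  simp only [iNorm, norm_twistedInvol, 𝒢.inv_inv]
  simp only [max_comm]

theorem integral_norm_twistedConv_le (f g : C_c(G, ℂ)) {C : ℝ}
    (hC : ∀ x, ∫ γ, ‖f γ‖ ∂(H.meas x) ≤ C) (x : X) :
    ∫ γ, ‖twistedConv H σ f g γ‖ ∂(H.meas x) ≤ C * ∫ γ, ‖g γ‖ ∂(H.meas x) := by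
  let τ := GroupoidCocycle.trivial 𝒢
  let abs : C_c(G, ℂ) → C_c(G, ℂ) := fun f => ⟨⟨fun γ => (‖f γ‖ : ℂ), by fun_prop⟩,
    f.hasCompactSupport.comp_left (g := fun z : ℂ => (‖z‖ : ℂ)) (by simp)⟩
  have habs : ∀ f γ, abs f γ = (‖f γ‖ : ℂ) := fun _ _ => rfl
  -- the convolution of the absolute values
  have hconv : ∀ γ, twistedConv H τ (abs f) (abs g) γ =
      ((∫ μ, ‖f (𝒢.mul γ (𝒢.inv μ))‖ * ‖g μ‖ ∂(H.meas (𝒢.src γ)) : ℝ) : ℂ) := fun γ => by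
    refine Eq.trans ?_ integral_ofReal
    refine integral_congr_ae (Eventually.of_forall fun μ => ?_)
    change abs f _ * abs g μ * ((1 : Circle) : ℂ) = _
    simp [habs]
  have hle : ∀ γ, ‖twistedConv H σ f g γ‖ ≤ (twistedConv H τ (abs f) (abs g) γ).re := fun γ => by
    rw [hconv, Complex.ofReal_re]
    refine (norm_integral_le_integral_norm _).trans (le_of_eq ?_)
    congr 1 with μ
    simp [Circle.norm_coe]
  have hI : Integrable (twistedConv H τ (abs f) (abs g)) (H.meas x) :=
    (continuous_twistedConv H τ _ _).integrable_of_hasCompactSupport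
      (hasCompactSupport_twistedConv H τ _ _)
  have hI' : Integrable (twistedConv H σ f g) (H.meas x) :=
    (continuous_twistedConv H σ _ _).integrable_of_hasCompactSupport
      (hasCompactSupport_twistedConv H σ _ _)
  have hcomp : ∫ γ, twistedConv H τ (abs f) (abs g) γ ∂(H.meas x) =
      ((∫ μ, (∫ γ, ‖f γ‖ ∂(H.meas (𝒢.rng μ))) * ‖g μ‖ ∂(H.meas x) : ℝ) : ℂ) := by
    have hdC : ContinuousOn (fun p : G × G => 𝒢.mul p.1 (𝒢.inv p.2))
        {p : G × G | 𝒢.src p.1 = x ∧ 𝒢.src p.2 = x} :=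
      𝒢.continuousOn_div.mono fun p hp => hp.1.trans hp.2.symm
    calc ∫ γ, twistedConv H τ (abs f) (abs g) γ ∂(H.meas x)
        = ∫ γ, ∫ μ, abs f (𝒢.mul γ (𝒢.inv μ)) * abs g μ ∂(H.meas x) ∂(H.meas x) := by
          refine integral_congr_ae ((H.ae_src x).mono fun γ hγ => ?_)
          have hγ' : 𝒢.src γ = x := hγ
          simp only [twistedConv, hγ']
          congr 1 with μ
          change _ * ((1 : Circle) : ℂ) = _
          simp
      _ = ∫ μ, ∫ γ, abs f (𝒢.mul γ (𝒢.inv μ)) * abs g μ ∂(H.meas x) ∂(H.meas x) := by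
          refine H.swap_of_continuousOn x x ((𝒢.isCompact_mulSet (abs f).hasCompactSupport
            (abs g).hasCompactSupport).prod (abs g).hasCompactSupport) ?_ ?_
          · exact ((abs f).continuous.comp_continuousOn hdC).mul
              ((abs g).continuous.comp_continuousOn continuousOn_snd)
          · intro γ μ hγ hμ hK
            by_cases hg : μ ∈ tsupport (abs g)
            · have hf : 𝒢.mul γ (𝒢.inv μ) ∉ tsupport (abs f) := fun hf =>
                hK ⟨𝒢.mem_mulSet_of_div (hγ.trans hμ.symm) hf hg, hg⟩
              rw [image_eq_zero_of_notMem_tsupport hf, zero_mul]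
            · rw [image_eq_zero_of_notMem_tsupport hg, mul_zero]
      _ = _ := by
          refine Eq.trans ?_ integral_ofReal
          refine integral_congr_ae ((H.ae_src x).mono fun μ hμ => ?_)
          have hμ' : 𝒢.src μ = x := hμ
          have hinv := H.invariant (𝒢.inv μ) (abs f)
          rw [𝒢.rng_inv, 𝒢.src_inv, hμ'] at hinv
          simp only [integral_mul_const]
          rw [hinv]
          have hof : ∫ γ, (‖f γ‖ : ℂ) ∂(H.meas (𝒢.rng μ)) =
            ((∫ γ, ‖f γ‖ ∂(H.meas (𝒢.rng μ)) : ℝ) : ℂ) := integral_ofReal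
          simp only [habs]
          rw [hof]
          simp
  have hC0 : Continuous fun μ => (∫ γ, ‖f γ‖ ∂(H.meas (𝒢.rng μ))) * ‖g μ‖ :=
    ((H.continuous_integral_norm f).comp 𝒢.continuous_rng).mul g.continuous.norm
  calc ∫ γ, ‖twistedConv H σ f g γ‖ ∂(H.meas x)
      ≤ ∫ γ, (twistedConv H τ (abs f) (abs g) γ).re ∂(H.meas x) :=
        integral_mono hI'.norm hI.re hle
    _ = (∫ γ, twistedConv H τ (abs f) (abs g) γ ∂(H.meas x)).re := integral_re hI
    _ = ∫ μ, (∫ γ, ‖f γ‖ ∂(H.meas (𝒢.rng μ))) * ‖g μ‖ ∂(H.meas x) := by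
        rw [hcomp, Complex.ofReal_re]
    _ ≤ ∫ μ, C * ‖g μ‖ ∂(H.meas x) := by
        refine integral_mono (hC0.integrable_of_hasCompactSupport
          (HasCompactSupport.mul_left g.hasCompactSupport.norm))
          ((H.integrable_norm g x).const_mul C) fun μ => ?_
        exact mul_le_mul_of_nonneg_right (hC _) (norm_nonneg _)
    _ = C * ∫ γ, ‖g γ‖ ∂(H.meas x) := integral_const_mul _ _

theorem iNorm_twistedConv_le (f g : C_c(G, ℂ)) :
    iNorm H (twistedConv H σ f g) ≤ iNorm H f * iNorm H g := by
  let fs : C_c(G, ℂ) := ⟨⟨_, continuous_twistedInvol σ f⟩, hasCompactSupport_twistedInvol σ f⟩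
  let gs : C_c(G, ℂ) := ⟨⟨_, continuous_twistedInvol σ g⟩, hasCompactSupport_twistedInvol σ g⟩
  let fg : C_c(G, ℂ) := ⟨⟨_, continuous_twistedConv H σ f g⟩, hasCompactSupport_twistedConv H σ f g⟩
  have hfs : iNorm H fs = iNorm H f := iNorm_twistedInvol H σ f
  have hgs : iNorm H gs = iNorm H g := iNorm_twistedInvol H σ g
  refine iNorm_le H _ (mul_nonneg (iNorm_nonneg H f) (iNorm_nonneg H g)) (fun x => ?_) fun x => ?_
  · exact (integral_norm_twistedConv_le H σ f g (integral_norm_le_iNorm H f) x).trans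
      (mul_le_mul_of_nonneg_left (integral_norm_le_iNorm H g x) (iNorm_nonneg H f))
  · have h := integral_norm_twistedConv_le H σ gs fs (integral_norm_le_iNorm H gs) x
    have h2 : ∀ γ, ‖twistedConv H σ f g (𝒢.inv γ)‖ = ‖twistedConv H σ gs fs γ‖ := fun γ => by
      rw [← twistedInvol_conv H σ f g fs gs fg (fun _ => rfl) (fun _ => rfl) (fun _ => rfl) γ,
        norm_twistedInvol]
      rfl
    simp_rw [h2]
    refine h.trans ?_
    rw [hgs, mul_comm (iNorm H f)]
    exact mul_le_mul_of_nonneg_left ((integral_norm_le_iNorm H fs x).trans_eq hfs)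
      (iNorm_nonneg H g)

end Convolution

section Algebra

variable {G X : Type*} [TopologicalSpace G] [TopologicalSpace X] [MeasurableSpace G]
  {𝒢 : TopGroupoid G X}

/-- The twisted convolution `*`-algebra `C_c(𝒢, σ)`: as a vector space `C_c(G)`, with the
`σ`-twisted convolution and involution, and with the `I`-norm. -/
def TwistedCc (_H : HaarSystem 𝒢) (_σ : GroupoidCocycle 𝒢) : Type _ := C_c(G, ℂ)

namespace TwistedCc

variable {H : HaarSystem 𝒢} {σ : GroupoidCocycle 𝒢}

instance : FunLike (TwistedCc H σ) G ℂ := inferInstanceAs (FunLike C_c(G, ℂ) G ℂ)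
noncomputable instance : AddCommGroup (TwistedCc H σ) := inferInstanceAs (AddCommGroup C_c(G, ℂ))
noncomputable instance : Module ℂ (TwistedCc H σ) := inferInstanceAs (Module ℂ C_c(G, ℂ))

@[ext] theorem ext {f g : TwistedCc H σ} (h : ∀ γ, f γ = g γ) : f = g := DFunLike.ext f g h
theorem add_apply (f g : TwistedCc H σ) (γ : G) : (f + g) γ = f γ + g γ := rfl
theorem neg_apply (f : TwistedCc H σ) (γ : G) : (-f) γ = -f γ := rfl
theorem zero_apply (γ : G) : (0 : TwistedCc H σ) γ = 0 := rfl
theorem smul_apply (c : ℂ) (f : TwistedCc H σ) (γ : G) : (c • f) γ = c * f γ := rfl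

variable [T2Space G] [LocallyCompactSpace G] [SecondCountableTopology G] [BorelSpace G]

noncomputable instance : Mul (TwistedCc H σ) where
  mul f g := (⟨⟨twistedConv H σ f g, continuous_twistedConv H σ f g⟩,
    hasCompactSupport_twistedConv H σ f g⟩ : C_c(G, ℂ))

theorem mul_apply (f g : TwistedCc H σ) (γ : G) : (f * g) γ = twistedConv H σ f g γ := rfl

/-- The `σ`-twisted involution of `C_c(𝒢, σ)`. -/
noncomputable def invol (f : TwistedCc H σ) : TwistedCc H σ :=
  (⟨⟨twistedInvol σ f, continuous_twistedInvol σ f⟩,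
    hasCompactSupport_twistedInvol σ f⟩ : C_c(G, ℂ))

noncomputable instance : Star (TwistedCc H σ) where
  star := invol

theorem star_apply (f : TwistedCc H σ) (γ : G) : (star f) γ = twistedInvol σ f γ := rfl

noncomputable instance : SeminormedAddCommGroup (TwistedCc H σ) :=
  AddGroupSeminorm.toSeminormedAddCommGroup
    { toFun := fun f => iNorm H f
      map_zero' := by
        refine le_antisymm (iNorm_le H _ le_rfl (fun x => ?_) fun x => ?_) (iNorm_nonneg H _) <;>
        simp [zero_apply]
      add_le' := fun f g => iNorm_add_le H f g
      neg' := fun f => by simp [iNorm, neg_apply] }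

noncomputable instance : NonUnitalSeminormedRing (TwistedCc H σ) where
  __ := (inferInstance : SeminormedAddCommGroup (TwistedCc H σ))
  left_distrib f g h := by
    ext γ
    rw [mul_apply, add_apply, mul_apply, mul_apply]
    refine Eq.trans ?_ (integral_add (convIntegrand_integrable H σ f g γ)
      (convIntegrand_integrable H σ f h γ))
    refine integral_congr_ae (Eventually.of_forall fun μ => ?_)
    simp only [add_apply]
    ring
  right_distrib f g h := by
    ext γ
    rw [mul_apply, add_apply, mul_apply, mul_apply]
    refine Eq.trans ?_ (integral_add (convIntegrand_integrable H σ f h γ)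
      (convIntegrand_integrable H σ g h γ))
    refine integral_congr_ae (Eventually.of_forall fun μ => ?_)
    simp only [add_apply]
    ring
  zero_mul f := by
    ext γ
    simp [mul_apply, twistedConv, zero_apply]
  mul_zero f := by
    ext γ
    simp [mul_apply, twistedConv, zero_apply]
  mul_assoc f g h := by
    ext γ
    exact twistedConv_assoc H σ f g h (f * g) (g * h) (fun _ => rfl) (fun _ => rfl) γ
  norm_mul_le f g := iNorm_twistedConv_le H σ f g

noncomputable instance : NormedSpace ℂ (TwistedCc H σ) where
  norm_smul_le c f := iNorm_smul_le H c f

instance : IsScalarTower ℂ (TwistedCc H σ) (TwistedCc H σ) where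
  smul_assoc c f g := by
    ext γ
    simp only [smul_eq_mul, mul_apply, smul_apply, twistedConv]
    rw [← integral_const_mul]
    congr 1 with μ
    ring

instance : SMulCommClass ℂ (TwistedCc H σ) (TwistedCc H σ) where
  smul_comm c f g := by
    ext γ
    simp only [smul_eq_mul, mul_apply, smul_apply, twistedConv]
    rw [← integral_const_mul]
    congr 1 with μ
    ring

noncomputable instance : StarRing (TwistedCc H σ) where
  star_involutive f := by
    ext γ
    exact twistedInvol_invol σ f (TwistedCc.invol f) (fun _ => rfl) γ
  star_mul f g := by
    ext γ
    exact twistedInvol_conv H σ f g (TwistedCc.invol f) (TwistedCc.invol g) (f * g) (fun _ => rfl)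
      (fun _ => rfl) (fun _ => rfl) γ
  star_add f g := by
    ext γ
    simp only [star_apply, add_apply, twistedInvol, map_add]
    ring

instance : StarModule ℂ (TwistedCc H σ) where
  star_smul c f := by
    ext γ
    simp only [star_apply, smul_apply, twistedInvol, map_mul, Complex.star_def]
    ring

instance : NormedStarGroup (TwistedCc H σ) where
  norm_star_le f := (iNorm_twistedInvol H σ f).le

theorem norm_def (f : TwistedCc H σ) : ‖f‖ = iNorm H f := rfl

end TwistedCc

end Algebra

/-! ## Completion of a normed `*`-algebra -/

namespace StarCompletion

variable {A : Type*} [NonUnitalSeminormedRing A]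

noncomputable instance : Mul (Completion A) where
  mul := Function.curry <| (Completion.isDenseInducing_coe.prodMap
    Completion.isDenseInducing_coe).extend ((↑) ∘ Function.uncurry (· * ·))

theorem coe_mul (a b : A) : ((a * b : A) : Completion A) = a * b :=
  ((Completion.isDenseInducing_coe.prodMap Completion.isDenseInducing_coe).extend_eq
    ((Completion.continuous_coe A).comp (@continuous_mul A _ _ _)) (a, b)).symm

instance : ContinuousMul (Completion A) where
  continuous_mul := by
    let m := (AddMonoidHom.mul : A →+ A →+ A).compr₂ Completion.toCompl
    have : Continuous fun p : A × A => m p.1 p.2 := (Completion.continuous_coe A).comp continuous_mul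
    have di : IsDenseInducing (Completion.toCompl : A → Completion A) :=
      Completion.isDenseInducing_coe
    exact (di.extend_Z_bilin di this :)

noncomputable instance : NonUnitalNormedRing (Completion A) where
  __ := (inferInstance : NormedAddCommGroup (Completion A))
  left_distrib a b c := Completion.induction_on₃ a b c
    (isClosed_eq (by fun_prop) (by fun_prop)) fun a b c => by
      rw [← Completion.coe_add, ← coe_mul, ← coe_mul, ← coe_mul, ← Completion.coe_add, mul_add]
  right_distrib a b c := Completion.induction_on₃ a b c
    (isClosed_eq (by fun_prop) (by fun_prop)) fun a b c => by
      rw [← Completion.coe_add, ← coe_mul, ← coe_mul, ← coe_mul, ← Completion.coe_add, add_mul]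
  zero_mul a := Completion.induction_on a
    (isClosed_eq (by fun_prop) (by fun_prop)) fun a => by
      rw [← Completion.coe_zero, ← coe_mul, zero_mul]
  mul_zero a := Completion.induction_on a
    (isClosed_eq (by fun_prop) (by fun_prop)) fun a => by
      rw [← Completion.coe_zero, ← coe_mul, mul_zero]
  mul_assoc a b c := Completion.induction_on₃ a b c
    (isClosed_eq (by fun_prop) (by fun_prop)) fun a b c => by
      rw [← coe_mul, ← coe_mul, ← coe_mul, ← coe_mul, mul_assoc]
  norm_mul_le a b := Completion.induction_on₂ a b
    (isClosed_le (by fun_prop) (by fun_prop)) fun a b => by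
      simpa only [← coe_mul, Completion.norm_coe] using norm_mul_le a b

instance [NormedSpace ℂ A] [IsScalarTower ℂ A A] :
    IsScalarTower ℂ (Completion A) (Completion A) where
  smul_assoc c a b := Completion.induction_on₂ a b
    (isClosed_eq ((continuous_fst.const_smul c).mul continuous_snd)
      ((continuous_fst.mul continuous_snd).const_smul c))
    fun a b => by
      change (c • (a : Completion A)) * (b : Completion A) = c • ((a : Completion A) * b)
      rw [← Completion.coe_smul, ← coe_mul, ← coe_mul, ← Completion.coe_smul, smul_mul_assoc]

instance [NormedSpace ℂ A] [SMulCommClass ℂ A A] :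
    SMulCommClass ℂ (Completion A) (Completion A) where
  smul_comm c a b := Completion.induction_on₂ a b
    (isClosed_eq ((continuous_fst.mul continuous_snd).const_smul c)
      (continuous_fst.mul (continuous_snd.const_smul c)))
    fun a b => by
      change c • ((a : Completion A) * (b : Completion A)) = a * (c • (b : Completion A))
      rw [← Completion.coe_smul, ← coe_mul, ← coe_mul, ← Completion.coe_smul, mul_smul_comm]

variable [StarRing A] [NormedStarGroup A]

noncomputable instance : Star (Completion A) where
  star := Completion.map star

theorem coe_star (a : A) : ((star a : A) : Completion A) = star (a : Completion A) :=
  (Completion.map_coe (starNormedAddGroupHom (E := A)).uniformContinuous a).symm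

instance : ContinuousStar (Completion A) where
  continuous_star := Completion.continuous_map

noncomputable instance : StarRing (Completion A) where
  star_involutive a := Completion.induction_on a
    (isClosed_eq (by fun_prop) (by fun_prop)) fun a => by
      rw [← coe_star, ← coe_star, star_star]
  star_mul a b := Completion.induction_on₂ a b
    (isClosed_eq (by fun_prop) (by fun_prop)) fun a b => by
      rw [← coe_mul, ← coe_star, ← coe_star, ← coe_star, ← coe_mul, star_mul]
  star_add a b := Completion.induction_on₂ a b
    (isClosed_eq (by fun_prop) (by fun_prop)) fun a b => by
      rw [← Completion.coe_add, ← coe_star, ← coe_star, ← coe_star, ← Completion.coe_add, star_add]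

instance [NormedSpace ℂ A] [StarModule ℂ A] : StarModule ℂ (Completion A) where
  star_smul c a := Completion.induction_on a
    (isClosed_eq (continuous_star.comp (continuous_id.const_smul c))
      (continuous_star.const_smul (star c))) fun a => by
      rw [← Completion.coe_smul, ← coe_star, ← coe_star, ← Completion.coe_smul, star_smul]

instance : NormedStarGroup (Completion A) where
  norm_star_le a := Completion.induction_on a
    (isClosed_le (by fun_prop) (by fun_prop)) fun a => by
      rw [← coe_star, Completion.norm_coe, Completion.norm_coe, norm_star]

end StarCompletion

/-! ## `L¹(𝒢, σ)` and Hermitian Banach `*`-algebras -/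

/-- The Banach `*`-algebra `L¹(𝒢, σ, λ)`: the completion of `C_c(𝒢, σ)` in the `I`-norm. -/
abbrev L1Alg {G X : Type*} [TopologicalSpace G] [TopologicalSpace X] [MeasurableSpace G]
    [T2Space G] [LocallyCompactSpace G] [SecondCountableTopology G] [BorelSpace G]
    {𝒢 : TopGroupoid G X} (H : HaarSystem 𝒢) (σ : GroupoidCocycle 𝒢) : Type _ :=
  Completion (TwistedCc H σ)

/-- `e` is a two-sided unit of `A`. -/
def IsUnitElement {A : Type*} [Mul A] (e : A) : Prop := ∀ b : A, e * b = b ∧ b * e = b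

open Classical in
/-- The spectrum of `a` in a complex algebra `A`: if `A` has a unit `e`, the set of `z` such that
`z e - a` is not invertible in `A`; otherwise, the spectrum of `a` in the minimal unitization. -/
noncomputable def algSpectrum (A : Type*) [NonUnitalRing A] [Module ℂ A] [IsScalarTower ℂ A A]
    [SMulCommClass ℂ A A] (a : A) : Set ℂ :=
  if h : ∃ e : A, IsUnitElement e then
    {z | ¬ ∃ b : A, b * (z • h.choose - a) = h.choose ∧ (z • h.choose - a) * b = h.choose}
  else spectrum ℂ (a : Unitization ℂ A)

/-- `A` is Hermitian: every Hermitian (self-adjoint) element has real spectrum. -/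
def IsHermitianAlg (A : Type*) [NonUnitalRing A] [StarRing A] [Module ℂ A] [IsScalarTower ℂ A A]
    [SMulCommClass ℂ A A] : Prop :=
  ∀ a : A, star a = a → ∀ z ∈ algSpectrum A a, z.im = 0

/-! ## The spectrum and the quasispectrum -/

section Spectrum

/-! The algebra `C_c(𝒢, σ)` sits inside `C_c(𝒢_σ)` as the component of weight one for the circle:
put ι f(γ, z) = f(γ) z, and let φ F(γ) = ∫ F(γ, z) conj z dη(z) be the first Fourier coefficient
along the circle. Then φ ∘ ι = id, so φ is a retraction.

The point is that φ is an algebra homomorphism on all of `C_c(𝒢_σ)`. Under untwisted convolution on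
𝒢_σ, functions of different weights multiply to zero, and functions of weight one multiply by the
σ-twisted convolution, because the circle coordinate of (γ, z)(μ, w)⁻¹ is z w⁻¹ σ(γμ⁻¹, μ)
(`twist_div`, `circle_integral_translate`, `circleCoeff_conv`). The map ι preserves the involution
(`circleLift_invol`). Since η is a probability measure and |z| = 1, φ is contractive and ι isometric
for the `I`-norms (`iNorm_circleCoeff_le`, `iNorm_circleLift`), so both extend to the completions.

A self-adjoint a in L¹(𝒢, σ) is therefore the image under φ of the self-adjoint element ι a of
L¹(𝒢_σ). Algebra homomorphisms do not enlarge the spectrum away from 0, so the nonzero spectrum of a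
lies in that of ι a, which is real by hypothesis; the point 0 is real anyway
(`IsHermitianAlg.of_lift`). Ignoring 0 allows the unit-free quasispectrum to be used throughout: it
makes no difference which of the two algebras is unital, or whether φ would preserve a unit. -/

theorem isQuasiregular_iff_of_isUnitElement {A : Type*} [NonUnitalRing A] {e : A} (he : IsUnitElement e) (c : A) :
    IsQuasiregular c ↔ ∃ b : A, b * (e + c) = e ∧ (e + c) * b = e := by
  rw [isQuasiregular_iff]
  constructor
  · rintro ⟨y, h1, h2⟩
    -- Quasi-inverses are inverses shifted by the unit: (e + y)(e + c) = e + (c + y + yc), and the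
    -- last bracket vanishes exactly when y is a left quasi-inverse of c.
    refine ⟨e + y, ?_, ?_⟩
    · rw [add_mul, mul_add, mul_add, (he e).1, (he c).1, (he y).2,
        show e + c + (y + y * c) = e + (c + y + y * c) by abel, h2, add_zero]
    · rw [add_mul, mul_add, mul_add, (he e).1, (he y).1, (he c).2,
        show e + y + (c + c * y) = e + (y + c + c * y) by abel, h1, add_zero]
  · rintro ⟨b, h1, h2⟩
    refine ⟨b - e, ?_, ?_⟩
    · rw [add_mul, (he b).1] at h2
      rw [mul_sub, (he c).2, show b - e + c + (c * b - c) = (b + c * b) - e by abel, h2, sub_self]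
    · rw [mul_add, (he b).2] at h1
      rw [sub_mul, (he c).1, show c + (b - e) + (b * c - c) = (b + b * c) - e by abel, h1, sub_self]

variable {A : Type*} [NonUnitalRing A] [Module ℂ A] [IsScalarTower ℂ A A] [SMulCommClass ℂ A A]

/-- For z ≠ 0, z e - a = z (e - z⁻¹ a), so invertibility is quasiregularity of -z⁻¹ a, a condition
that does not mention the unit; without a unit, the quasispectrum is the spectrum in the
unitization. The point 0 must be left out: it always lies in the quasispectrum, but not in the
spectrum of an invertible element. -/
theorem mem_algSpectrum_iff_mem_quasispectrum (a : A) {z : ℂ} (hz : z ≠ 0) :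
    z ∈ algSpectrum A a ↔ z ∈ quasispectrum ℂ a := by
  unfold algSpectrum
  split_ifs with h
  · have he := h.choose_spec
    set e := h.choose
    change (¬ ∃ b : A, b * (z • e - a) = e ∧ (z • e - a) * b = e) ↔
      ∀ hr : IsUnit z, ¬ IsQuasiregular (-(hr.unit⁻¹ • a))
    rw [forall_prop_of_true (isUnit_iff_ne_zero.2 hz), not_iff_not,
      isQuasiregular_iff_of_isUnitElement he]
    have hu : (isUnit_iff_ne_zero.2 hz).unit⁻¹ • a = z⁻¹ • a := by
      rw [Units.smul_def]; simp
    have hs : z • e - a = z • (e + -(z⁻¹ • a)) := by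
      rw [smul_add, smul_neg, smul_inv_smul₀ hz, sub_eq_add_neg]
    rw [hu, hs]
    -- The nonzero scalar z moves between the element and its inverse, so b becomes z b in one
    -- direction and z⁻¹ b in the other.
    constructor
    · rintro ⟨b, h1, h2⟩
      refine ⟨z • b, ?_, ?_⟩
      · rwa [smul_mul_assoc, ← mul_smul_comm]
      · rwa [mul_smul_comm, ← smul_mul_assoc]
    · rintro ⟨b, h1, h2⟩
      refine ⟨z⁻¹ • b, ?_, ?_⟩
      · rwa [smul_mul_assoc, mul_smul_comm, inv_smul_smul₀ hz]
      · rwa [smul_mul_assoc, mul_smul_comm, smul_inv_smul₀ hz]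
  · rw [Unitization.quasispectrum_eq_spectrum_inr]

/-- The Hermitian property passes to images of algebra homomorphisms along which self-adjoint
elements lift. -/
theorem IsHermitianAlg.of_lift {B : Type*} [NonUnitalRing B] [StarRing A] [StarRing B]
    [Module ℂ B] [IsScalarTower ℂ B B] [SMulCommClass ℂ B B] (hB : IsHermitianAlg B)
    (φ : B →ₙₐ[ℂ] A) (hφ : ∀ a : A, star a = a → ∃ b : B, star b = b ∧ φ b = a) :
    IsHermitianAlg A := by
  intro a ha z hz
  obtain ⟨b, hb, rfl⟩ := hφ a ha
  -- The two notions of spectrum can differ only at 0, and 0 is real.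
  by_cases h0 : z = 0
  · simp [h0]
  · refine hB b hb z ((mem_algSpectrum_iff_mem_quasispectrum b h0).2 ?_)
    exact NonUnitalAlgHom.quasispectrum_apply_subset φ b
      ((mem_algSpectrum_iff_mem_quasispectrum _ h0).1 hz)

end Spectrum

/-! ## Extension of homomorphisms to completions -/

namespace StarCompletion

variable {A B : Type*} [NonUnitalSeminormedRing A] [NonUnitalSeminormedRing B]
  [NormedSpace ℂ A] [NormedSpace ℂ B]

/-- The extension of a continuous algebra homomorphism to the completions. -/
noncomputable def mapAlgHom (φ : A →+ B) (hφ : Continuous φ)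
    (hsmul : ∀ (c : ℂ) (a : A), φ (c • a) = c • φ a) (hmul : ∀ a b, φ (a * b) = φ a * φ b) :
    Completion A →ₙₐ[ℂ] Completion B :=
  have hc := AddMonoidHom.continuous_completion φ hφ
  { φ.completion hφ with
    map_smul' := fun c a => Completion.induction_on a
      (isClosed_eq (hc.comp (continuous_const_smul c)) (hc.const_smul c)) fun a => by
        change φ.completion hφ (c • (a : Completion A)) = c • φ.completion hφ (a : Completion A)
        rw [← Completion.coe_smul, AddMonoidHom.completion_coe, AddMonoidHom.completion_coe,
          ← Completion.coe_smul, hsmul]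
    map_mul' := fun a b => Completion.induction_on₂ a b
      (isClosed_eq (hc.comp continuous_mul)
        ((hc.comp continuous_fst).mul (hc.comp continuous_snd))) fun a b => by
        change φ.completion hφ ((a : Completion A) * (b : Completion A)) =
          φ.completion hφ (a : Completion A) * φ.completion hφ (b : Completion A)
        rw [← coe_mul, AddMonoidHom.completion_coe, AddMonoidHom.completion_coe,
          AddMonoidHom.completion_coe, ← coe_mul, hmul] }

/-- The element ι a is the self-adjoint lift of a. The two maps share the work: φ has to respect the
algebra structure but not the involution, ι the involution but not the product. All identities pass
from the dense subalgebras to the completions by continuity. -/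
theorem isHermitianAlg_of_retraction [IsScalarTower ℂ A A]
    [SMulCommClass ℂ A A] [IsScalarTower ℂ B B] [SMulCommClass ℂ B B] [StarRing A] [StarRing B]
    [NormedStarGroup A] [NormedStarGroup B] (φ : B →+ A) (hφ : Continuous φ)
    (hsmul : ∀ (c : ℂ) (b : B), φ (c • b) = c • φ b) (hmul : ∀ a b, φ (a * b) = φ a * φ b)
    (ι : A →+ B) (hι : Continuous ι) (hstar : ∀ a, ι (star a) = star (ι a))
    (hφι : ∀ a, φ (ι a) = a) (hB : IsHermitianAlg (Completion B)) :
    IsHermitianAlg (Completion A) := by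
  have hc := AddMonoidHom.continuous_completion ι hι
  refine hB.of_lift (mapAlgHom φ hφ hsmul hmul) fun a ha => ⟨ι.completion hι a, ?_, ?_⟩
  · conv_rhs => rw [← ha]
    refine Completion.induction_on a
      (isClosed_eq (continuous_star.comp hc) (hc.comp continuous_star)) fun a => ?_
    rw [← coe_star, AddMonoidHom.completion_coe, AddMonoidHom.completion_coe, hstar, coe_star]
  · change φ.completion hφ (ι.completion hι a) = a
    refine Completion.induction_on a
      (isClosed_eq ((AddMonoidHom.continuous_completion φ hφ).comp hc) continuous_id) fun a => ?_
    rw [AddMonoidHom.completion_coe, AddMonoidHom.completion_coe, hφι]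

end StarCompletion

/-! ## The spectral component of weight one of `C_c(𝒢_σ)` -/

/-- The integrand is |z|² = 1 and the measure has mass 1; this normalization makes the coefficient
map a left inverse of the lift. -/
theorem Circle.integral_conj_mul_self : ∫ z : Circle, (z : ℂ) * conj (z : ℂ) ∂circleMeasure = 1 := by
  simp [Complex.mul_conj, Circle.normSq_coe]

section Component

variable {G : Type*} [TopologicalSpace G]

/-- The function `(γ, z) ↦ f(γ) z`. -/
noncomputable def circleLift [T2Space G] (f : C_c(G, ℂ)) : C_c(G × Circle, ℂ) :=
  ⟨⟨fun p => f p.1 * (p.2 : ℂ), by fun_prop⟩,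
    HasCompactSupport.intro (f.hasCompactSupport.prod isCompact_univ) fun p hp => by
      have : p.1 ∉ tsupport f := fun h => hp ⟨h, trivial⟩
      simp [image_eq_zero_of_notMem_tsupport this]⟩

/-- The function `(γ, z) ↦ F(γ, z) conj z`. -/
noncomputable def circleTwist (F : C_c(G × Circle, ℂ)) : C_c(G × Circle, ℂ) :=
  ⟨⟨fun p => F p * conj (p.2 : ℂ), by fun_prop⟩, F.hasCompactSupport.mul_right⟩

theorem circle_integrable (F : C_c(G × Circle, ℂ)) (γ : G) :
    Integrable (fun z => F (γ, z)) circleMeasure := by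
  have h : Continuous fun z => F (γ, z) := by fun_prop
  exact h.integrable_of_hasCompactSupport (HasCompactSupport.of_compactSpace _)

variable {X : Type*} [TopologicalSpace X] {𝒢 : TopGroupoid G X}

/-! ### Division and involution in 𝒢_σ -/

section

variable (σ : GroupoidCocycle 𝒢)

/-- The cocycle identity for (γ, μ⁻¹, μ) gives σ(γ, μ⁻¹) σ(γμ⁻¹, μ) = σ(μ⁻¹, μ) = σ(μ, μ⁻¹). This is
where the twisting factor of the convolution comes from: it appears as a rotation of the circle
coordinate. -/
theorem twist_div (γ μ : G) (h : 𝒢.src γ = 𝒢.src μ) (z w : Circle) :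
    (𝒢.twist σ).mul (γ, z) ((𝒢.twist σ).inv (μ, w)) =
      (𝒢.mul γ (𝒢.inv μ), z * w⁻¹ * σ (𝒢.mul γ (𝒢.inv μ)) μ) := by
  refine Prod.ext rfl ?_
  change z * (w⁻¹ * σ μ (𝒢.inv μ)) * (σ γ (𝒢.inv μ))⁻¹ = _
  have hc := σ.cocycle γ (𝒢.inv μ) μ (h.trans (𝒢.rng_inv μ).symm) (𝒢.src_inv μ)
  rw [𝒢.inv_mul, ← h, σ.unit_right, mul_one, σ.inv_symm] at hc
  rw [← hc]
  simp [mul_assoc, mul_comm, mul_left_comm]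

/-- Conjugating the circle coordinate conj z σ(γ, γ⁻¹) of (γ, z)⁻¹ gives z conj σ(γ, γ⁻¹), so weight
one is preserved and the factor of the twisted involution appears, by the symmetry σ(γ, γ⁻¹) =
σ(γ⁻¹, γ). -/
theorem circleLift_invol [T2Space G] (f fs : C_c(G, ℂ)) (hfs : ∀ γ, fs γ = twistedInvol σ f γ)
    (p : G × Circle) : circleLift fs p =
      twistedInvol (GroupoidCocycle.trivial (𝒢.twist σ)) (circleLift f) p := by
  rcases p with ⟨γ, z⟩
  change fs γ * (z : ℂ) = conj ((1 : Circle) : ℂ) *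
    conj (f (𝒢.inv γ) * ((z⁻¹ * σ γ (𝒢.inv γ) : Circle) : ℂ))
  rw [hfs, twistedInvol, σ.inv_symm]
  simp only [Circle.coe_mul, Circle.coe_inv_eq_conj, Circle.coe_one, map_mul, map_one,
    Complex.conj_conj]
  ring

end

/-! ### The weight-one Fourier coefficient -/

variable [MeasurableSpace G] [T2Space G] [LocallyCompactSpace G] [SecondCountableTopology G]
  [BorelSpace G]

/-- The function `γ ↦ ∫ F(γ, z) conj z dη(z)`. -/
noncomputable def circleCoeff (F : C_c(G × Circle, ℂ)) : C_c(G, ℂ) :=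
  ⟨⟨_, continuous_circle_integral (circleTwist F)⟩, hasCompactSupport_circle_integral _⟩

theorem circleCoeff_apply (F : C_c(G × Circle, ℂ)) (γ : G) :
    circleCoeff F γ = ∫ z, F (γ, z) * conj (z : ℂ) ∂circleMeasure := rfl

theorem circleCoeff_circleLift (f : C_c(G, ℂ)) (γ : G) : circleCoeff (circleLift f) γ = f γ := by
  rw [circleCoeff_apply]
  change ∫ z : Circle, f γ * (z : ℂ) * conj (z : ℂ) ∂circleMeasure = f γ
  simp_rw [mul_assoc]
  rw [integral_const_mul, Circle.integral_conj_mul_self, mul_one]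

theorem norm_circleCoeff_le (F : C_c(G × Circle, ℂ)) (γ : G) :
    ‖circleCoeff F γ‖ ≤ ∫ z, ‖F (γ, z)‖ ∂circleMeasure := by
  refine (norm_integral_le_integral_norm _).trans (le_of_eq ?_)
  congr 1 with z
  change ‖F (γ, z) * conj (z : ℂ)‖ = _
  simp [Circle.norm_coe]

/-! ### `I`-norm bounds and multiplicativity of the coefficient map -/

variable (H : HaarSystem 𝒢) (σ : GroupoidCocycle 𝒢)

theorem integral_twist (x : X) {E : Type*} [NormedAddCommGroup E] [NormedSpace ℝ E]
    {F : G × Circle → E} (hF : Integrable F ((H.twist σ).meas x)) :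
    ∫ p, F p ∂((H.twist σ).meas x) = ∫ γ, ∫ z, F (γ, z) ∂circleMeasure ∂(H.meas x) :=
  integral_prod _ hF

theorem integral_norm_circleCoeff_le (F : C_c(G × Circle, ℂ)) (x : X) :
    ∫ γ, ‖circleCoeff F γ‖ ∂(H.meas x) ≤ ∫ p, ‖F p‖ ∂((H.twist σ).meas x) := by
  have hF : Integrable (fun p => ‖F p‖) ((H.twist σ).meas x) := (H.twist σ).integrable_norm F x
  rw [integral_twist H σ x hF]
  exact integral_mono (H.integrable_norm _ x) hF.integral_prod_left (norm_circleCoeff_le F)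

/-- Inversion in 𝒢_σ sends z to z⁻¹ σ(γ, γ⁻¹) on the circle, and η is invariant under inversion and
rotation, so the fibre integral of |F| over (γ, z)⁻¹ equals the one over γ⁻¹. -/
theorem integral_norm_circleCoeff_inv_le (F : C_c(G × Circle, ℂ)) (x : X) :
    ∫ γ, ‖circleCoeff F (𝒢.inv γ)‖ ∂(H.meas x) ≤
      ∫ p, ‖F ((𝒢.twist σ).inv p)‖ ∂((H.twist σ).meas x) := by
  have hF : Integrable (fun p => ‖F ((𝒢.twist σ).inv p)‖) ((H.twist σ).meas x) :=
    (H.twist σ).integrable_norm ((𝒢.twist σ).compInv F) x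
  rw [integral_twist H σ x hF]
  refine integral_mono (H.integrable_norm (𝒢.compInv (circleCoeff F)) x) hF.integral_prod_left
    fun γ => (norm_circleCoeff_le F _).trans (le_of_eq ?_)
  change _ = ∫ z, ‖F (𝒢.inv γ, z⁻¹ * σ γ (𝒢.inv γ))‖ ∂circleMeasure
  rw [integral_inv_eq_self (fun z => ‖F (𝒢.inv γ, z * σ γ (𝒢.inv γ))‖),
    integral_mul_right_eq_self (fun z => ‖F (𝒢.inv γ, z)‖)]

theorem iNorm_circleCoeff_le (F : C_c(G × Circle, ℂ)) :
    iNorm H (circleCoeff F) ≤ iNorm (H.twist σ) F :=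
  iNorm_le H _ (iNorm_nonneg _ _)
    (fun x => (integral_norm_circleCoeff_le H σ F x).trans (integral_norm_le_iNorm _ F x))
    fun x => (integral_norm_circleCoeff_inv_le H σ F x).trans (integral_norm_inv_le_iNorm _ F x)

/-- Multiplying by z does not change absolute values, and integrating a function of γ alone over the
circle factor gives mass 1. -/
theorem iNorm_circleLift (f : C_c(G, ℂ)) : iNorm (H.twist σ) (circleLift f) = iNorm H f := by
  have h : ∀ p : G × Circle, ‖circleLift f p‖ = ‖f p.1‖ := fun p => by
    change ‖f p.1 * (p.2 : ℂ)‖ = _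
    simp [Circle.norm_coe]
  have key : ∀ (f : C_c(G, ℂ)) x, ∫ p, ‖f p.1‖ ∂((H.twist σ).meas x) = ∫ γ, ‖f γ‖ ∂(H.meas x) := by
    intro f x
    change ∫ p, ‖f p.1‖ ∂((H.meas x).prod circleMeasure) = _
    rw [integral_fun_fst (fun γ => ‖f γ‖)]
    simp
  simp only [iNorm, h]
  congr 1 with x
  rw [key f x]
  congr 1
  -- The first coordinate of an inverse in 𝒢_σ is γ⁻¹, so the second half of the norm is the first
  -- half for f ∘ inv.
  exact key (𝒢.compInv f) x

/-- `conj z` integrated against a left translate. -/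
theorem circle_integral_translate (φ : Circle → ℂ) (w s : Circle) :
    ∫ z : Circle, φ (z * w⁻¹ * s) * conj (z : ℂ) ∂circleMeasure =
      (∫ z : Circle, φ z * conj (z : ℂ) ∂circleMeasure) * conj (w : ℂ) * s := by
  -- Invariance is applied to φ(z) conj z times the constant conj w · s: after z is replaced by z
  -- w⁻¹ s, this constant cancels the unwanted factor in conj (z w⁻¹ s) and leaves conj z.
  have h := integral_mul_right_eq_self (μ := circleMeasure)
    (fun z : Circle => φ z * conj (z : ℂ) * (conj (w : ℂ) * s)) (w⁻¹ * s)
  rw [mul_assoc, ← integral_mul_const]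
  refine Eq.trans ?_ h
  congr 1 with z
  have e : conj (z : ℂ) = conj ((z * (w⁻¹ * s) : Circle) : ℂ) * (conj (w : ℂ) * s) := by
    simp only [← Circle.coe_inv_eq_conj, ← Circle.coe_mul]
    rw [mul_inv, inv_mul_cancel_right]
  rw [mul_assoc z, e]
  ring

/-- Integrating over z first, the rotation by w⁻¹ σ(γμ⁻¹, μ) in the argument of F₁ comes out as conj
w · σ(γμ⁻¹, μ). The factor conj w is what F₂(μ, w) needs to form its own weight-one coefficient, and
σ(γμ⁻¹, μ) is the twist of the convolution. -/
theorem circleCoeff_conv (F₁ F₂ F : C_c(G × Circle, ℂ))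
    (hF : ∀ p, F p = twistedConv (H.twist σ) (GroupoidCocycle.trivial _) F₁ F₂ p) (γ : G) :
    circleCoeff F γ = twistedConv H σ (circleCoeff F₁) (circleCoeff F₂) γ := by
  set x := 𝒢.src γ with hx
  let D : Circle → G × Circle → ℂ := fun z p =>
    F₁ ((𝒢.twist σ).mul (γ, z) ((𝒢.twist σ).inv p)) * F₂ p * conj (z : ℂ)
  have hL : circleCoeff F γ = ∫ z, ∫ p, D z p ∂((H.twist σ).meas x) ∂circleMeasure := by
    rw [circleCoeff_apply]
    congr 1 with z
    rw [hF, twistedConv, ← integral_mul_const]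
    change ∫ p, F₁ _ * F₂ p * ((1 : Circle) : ℂ) * conj (z : ℂ) ∂((H.twist σ).meas x) = _
    simp only [Circle.coe_one, mul_one]
    rfl
  have hsupp : ∀ p, p ∉ tsupport F₂ → ∀ z, D z p = 0 := fun p hp z => by
    simp [D, image_eq_zero_of_notMem_tsupport hp]
  have hD : ContinuousOn (fun q : Circle × (G × Circle) => D q.1 q.2) {q | 𝒢.src q.2.1 = x} := by
    have hd : ContinuousOn (fun q : Circle × (G × Circle) =>
        (𝒢.twist σ).mul (γ, q.1) ((𝒢.twist σ).inv q.2)) {q | 𝒢.src q.2.1 = x} :=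
      (𝒢.twist σ).continuousOn_div.comp (f := fun q : Circle × (G × Circle) => ((γ, q.1), q.2))
        (by fun_prop) fun q hq => Eq.symm hq
    exact ((F₁.continuous.comp_continuousOn hd).mul (by fun_prop)).mul (by fun_prop)
  have hC : IsClosed {q : Circle × (G × Circle) | 𝒢.src q.2.1 = x} :=
    (𝒢.isClosed_fibre x).preimage (continuous_fst.comp continuous_snd)
  have hae : ∀ᵐ p ∂((H.twist σ).meas x), 𝒢.src p.1 = x := (H.twist σ).ae_src x
  have hswap : ∫ z, ∫ p, D z p ∂((H.twist σ).meas x) ∂circleMeasure =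
      ∫ p, ∫ z, D z p ∂circleMeasure ∂((H.twist σ).meas x) := by
    -- The integrand is controlled only on the source fibre, where division makes sense; it is
    -- replaced by a compactly supported continuous function on the whole product, equal to it
    -- almost everywhere, before the integrals are exchanged.
    obtain ⟨d, hd⟩ := exists_compactlySupported_eqOn hC
      (isCompact_univ.prod F₂.hasCompactSupport) hD
      fun q _ hq => hsupp q.2 (fun h => hq ⟨trivial, h⟩) q.1
    have h := integral_integral_swap_of_hasCompactSupport (f := fun z p => d (z, p))
      (μ := circleMeasure) (ν := (H.twist σ).meas x) d.continuous d.hasCompactSupport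
    calc _ = ∫ z, ∫ p, d (z, p) ∂((H.twist σ).meas x) ∂circleMeasure := by
          congr 1 with z
          exact integral_congr_ae (hae.mono fun p hp => (hd (x := (z, p)) hp).symm)
      _ = _ := h
      _ = _ := integral_congr_ae (hae.mono fun p hp =>
          integral_congr_ae (Eventually.of_forall fun z => hd (x := (z, p)) hp))
  have hinner : ∀ p : G × Circle, 𝒢.src p.1 = x → ∫ z, D z p ∂circleMeasure =
      circleCoeff F₁ (𝒢.mul γ (𝒢.inv p.1)) * (F₂ p * conj (p.2 : ℂ)) *
        (σ (𝒢.mul γ (𝒢.inv p.1)) p.1 : ℂ) := by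
    rintro ⟨μ, w⟩ hp
    have hp' : 𝒢.src γ = 𝒢.src μ := hx.symm.trans (Eq.symm hp)
    have h := circle_integral_translate (fun z => F₁ (𝒢.mul γ (𝒢.inv μ), z)) w
      (σ (𝒢.mul γ (𝒢.inv μ)) μ)
    -- F₂(μ, w) is constant in z; moving it to the end leaves a translate of F₁ against conj z.
    simp only [D, twist_div σ γ μ hp', mul_right_comm _ (F₂ (μ, w))]
    rw [integral_mul_const, h, ← circleCoeff_apply]
    ring
  have hint : Integrable (fun p : G × Circle => circleCoeff F₁ (𝒢.mul γ (𝒢.inv p.1)) *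
      (F₂ p * conj (p.2 : ℂ)) * (σ (𝒢.mul γ (𝒢.inv p.1)) p.1 : ℂ)) ((H.twist σ).meas x) := by
    refine (H.twist σ).integrable_of_continuousOn x F₂.hasCompactSupport ?_ fun p _ hp => by
      simp [image_eq_zero_of_notMem_tsupport hp]
    have hf : ContinuousOn (fun p : G × Circle => (γ, p.1)) {p | 𝒢.src p.1 = x} := by fun_prop
    exact (((circleCoeff F₁).continuous.comp_continuousOn
      (𝒢.continuousOn_div.comp hf fun p hp => Eq.symm hp)).mul (by fun_prop)).mul
      (σ.continuousOn_div.comp hf fun p hp => Eq.symm hp)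
  rw [hL, hswap, integral_congr_ae (hae.mono hinner), integral_twist H σ x hint, twistedConv]
  congr 1 with μ
  change ∫ z : Circle, circleCoeff F₁ (𝒢.mul γ (𝒢.inv μ)) * (F₂ (μ, z) * conj (z : ℂ)) *
    (σ (𝒢.mul γ (𝒢.inv μ)) μ : ℂ) ∂circleMeasure = _
  rw [integral_mul_const, integral_const_mul, ← circleCoeff_apply]

end Component

/-! ### The lift and the coefficient as additive maps of convolution algebras -/

section Retraction

variable {G X : Type*} [TopologicalSpace G] [TopologicalSpace X] [MeasurableSpace G]
  {𝒢 : TopGroupoid G X} [T2Space G] [LocallyCompactSpace G] [SecondCountableTopology G]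
  [BorelSpace G]

namespace TwistedCc

/-- `circleLift` as an additive map `C_c(𝒢, σ) → C_c(𝒢_σ)`. -/
noncomputable def liftHom (H : HaarSystem 𝒢) (σ : GroupoidCocycle 𝒢) :
    TwistedCc H σ →+ TwistedCc (H.twist σ) (GroupoidCocycle.trivial (𝒢.twist σ)) where
  toFun f := circleLift f
  map_zero' := by
    ext p
    exact zero_mul (p.2 : ℂ)
  map_add' f g := by
    ext p
    exact add_mul (f p.1) (g p.1) (p.2 : ℂ)

/-- `circleCoeff` as an additive map `C_c(𝒢_σ) → C_c(𝒢, σ)`. -/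
noncomputable def coeffHom (H : HaarSystem 𝒢) (σ : GroupoidCocycle 𝒢) :
    TwistedCc (H.twist σ) (GroupoidCocycle.trivial (𝒢.twist σ)) →+ TwistedCc H σ where
  toFun F := circleCoeff F
  map_zero' := by
    ext γ
    refine (circleCoeff_apply _ γ).trans (integral_eq_zero_of_ae (Eventually.of_forall fun z => ?_))
    exact zero_mul (conj (z : ℂ))
  map_add' F F' := by
    ext γ
    refine Eq.trans ?_ (integral_add (circle_integrable (circleTwist F) γ)
      (circle_integrable (circleTwist F') γ))
    refine integral_congr_ae (Eventually.of_forall fun z => ?_)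
    exact add_mul (F (γ, z)) (F' (γ, z)) (conj (z : ℂ))

end TwistedCc

end Retraction

theorem mainTheorem5 {G X : Type*} [TopologicalSpace G] [TopologicalSpace X]
    [T2Space G] [LocallyCompactSpace G] [SecondCountableTopology G]
    [MeasurableSpace G] [BorelSpace G]
    (𝒢 : TopGroupoid G X) (H : HaarSystem 𝒢) (σ : GroupoidCocycle 𝒢)
    (hHerm : IsHermitianAlg (L1Alg (H.twist σ) (GroupoidCocycle.trivial (𝒢.twist σ)))) :
    IsHermitianAlg (L1Alg H σ) := by
  -- The bound 1 is used for both maps: the coefficient map is contractive and the lift is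
  -- isometric.
  refine StarCompletion.isHermitianAlg_of_retraction (TwistedCc.coeffHom H σ)
    (AddMonoidHomClass.continuous_of_bound _ 1 fun F => ?_) (fun c F => ?_) (fun F F' => ?_)
    (TwistedCc.liftHom H σ) (AddMonoidHomClass.continuous_of_bound _ 1 fun f => ?_)
    (fun f => ?_) (fun f => ?_) hHerm
  · rw [one_mul]
    exact iNorm_circleCoeff_le H σ F
  · ext γ
    refine Eq.trans ?_ (integral_const_mul c fun z => F (γ, z) * conj (z : ℂ))
    refine integral_congr_ae (Eventually.of_forall fun z => ?_)
    exact mul_assoc c (F (γ, z)) (conj (z : ℂ))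
  · ext γ
    exact circleCoeff_conv H σ F F' (F * F') (fun _ => rfl) γ
  · rw [one_mul]
    exact (iNorm_circleLift H σ f).le
  · ext p
    exact circleLift_invol σ f (TwistedCc.invol f) (fun _ => rfl) p
  · ext γ
    exact circleCoeff_circleLift f γ
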